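/- Let $S$ be a connected smooth finite-dimensional manifold (Hausdorff, second countable, without boundary), $g_0$ a smooth Riemannian metric, $\omega_0$ a smooth one-form and $\beta>0$ a smooth function on $S$. Consider the standard stationary spacetime $L=S\times\mathbb R$ with the Lorentzian metric $$g_L\big((y,\tau),(y,\tau)\big)=g_0(y,y)+2\,\omega_0(y)\,\tau-\beta\,\tau^2 ,\qquad (y,\tau)\in T_xS\times\mathbb R .$$ A tangent vector $v$ of $L$ is lightlike if $v\neq0$ and $g_L(v,v)=0$; a geodesic of $g_L$ is lightlike if its velocity is. Let $H_S\subset S$ be an embedded hypersurface of class $C^2$ and put $H=H_S\times\mathbb R$. A local defining function of $H$ on an open set $U\subset L$ is a $C^2$ function $\Phi:U\to\mathbb R$ with $\Phi^{-1}(0)=U\cap H$ and $d\Phi\neq0$ at every point of $U\cap H$. For such $(U,\Phi)$ consider the conditions: (I) for every $z\in U\cap H$ and every lightlike $v\in T_zH$ one has $H^{g_L}_\Phi(v,v)\le0$, where $H^{g_L}_\Phi=\nabla(d\Phi)$ is the Hessian with respect to the Levi-Civita connection of $g_L$; (L) every $z\in U\cap H$ has an open neighbourhood $V\subset U$ such that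 every lightlike geodesic contained in $V$ that passes through $z$ and is tangent to $H$ at $z$ lies in the local exterior $\{\Phi\le0\}$. The hypersurface $H$ is called infinitesimally light-convex (respectively locally light-convex) if every point of $H$ has an open neighbourhood $U$ with a local defining function $\Phi$ of $H$ on $U$ that satisfies (I) (respectively (L)). Then $H$ is infinitesimally light-convex if and only if it is locally light-convex. Moreover the equivalence holds with the same choice of sides: for every open $U\subset L$ and every local defining function $\Phi$ of $H$ on $U$, condition (I) holds if and only if condition (L) holds. -/

import Mathlib

open Set
open scoped Manifold ContDiff Topology

noncomputable section

namespace LightConvexity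

/-! ### Pseudo-Riemannian geometry in charts

A (possibly indefinite) metric on a manifold `M` without boundary is given by the family of bilinear
forms `g p : T_pM × T_pM → ℝ`. -/

section General

variable {F : Type*} [NormedAddCommGroup F] [NormedSpace ℝ F]
  {K : Type*} [TopologicalSpace K] (I : ModelWithCorners ℝ F K)
  {M : Type*} [TopologicalSpace M] [ChartedSpace K M]

/-- The coefficients of the metric `g` in the preferred chart around `p`: at the coordinate point
`e`, the pull-back of `g` under the inverse of the chart. -/
def chartMetric (g : ∀ q : M, TangentSpace I q →L[ℝ] TangentSpace I q →L[ℝ] ℝ)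
    (p : M) (e : F) : F →L[ℝ] F →L[ℝ] ℝ :=
  let D : F →L[ℝ] TangentSpace I ((extChartAt I p).symm e) :=
    mfderiv 𝓘(ℝ, F) I (extChartAt I p).symm e
  (ContinuousLinearMap.precomp ℝ D).comp ((g ((extChartAt I p).symm e)).comp D)

/-- Christoffel symbols of the first kind,
`Γ(u, v; w) = (∂_u g (v, w) + ∂_v g (u, w) - ∂_w g (u, v)) / 2`, as a covector in `w`. -/
def christoffelFirst (G : F → F →L[ℝ] F →L[ℝ] ℝ) (e u v : F) : F →L[ℝ] ℝ :=
  (1 / 2 : ℝ) • (fderiv ℝ G e u v + fderiv ℝ G e v u - ((fderiv ℝ G e).flip u).flip v)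

/-- Christoffel symbols of the second kind `Γ(u, v)`, obtained by raising the index of
`christoffelFirst`: these are the components of the Levi-Civita connection. -/
def christoffel (G : F → F →L[ℝ] F →L[ℝ] ℝ) (e u v : F) : F :=
  (G e).inverse (christoffelFirst G e u v)

/-- The Hessian `H_φ = ∇(dφ)` with respect to the Levi-Civita connection of `g`, at `z`, evaluated
at `(v, v)`: in coordinates `∂²φ/∂xⁱ∂xʲ vⁱvʲ - ∂φ/∂xᵏ Γᵏᵢⱼ vⁱvʲ`. -/
def hessian (g : ∀ q : M, TangentSpace I q →L[ℝ] TangentSpace I q →L[ℝ] ℝ)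
    (φ : M → ℝ) (z : M) (v : TangentSpace I z) : ℝ :=
  let f : F → ℝ := fun e => φ ((extChartAt I z).symm e)
  let e : F := extChartAt I z z
  let y : F := mfderiv I 𝓘(ℝ, F) (extChartAt I z) z v
  fderiv ℝ (fderiv ℝ f) e y y - fderiv ℝ f e (christoffel (chartMetric I g z) e y y)

/-- The velocity of a curve. -/
def velocity (γ : ℝ → M) (s : ℝ) : TangentSpace I (γ s) :=
  mfderiv 𝓘(ℝ, ℝ) I γ s (1 : ℝ)

/-- `γ` is an (affinely parametrized) geodesic of `g` on the open set `J` of parameters: it is `C²`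
there and satisfies `c'' + Γ(c', c') = 0`, where `c` is its coordinate expression. -/
def IsGeodesicOn (g : ∀ q : M, TangentSpace I q →L[ℝ] TangentSpace I q →L[ℝ] ℝ)
    (γ : ℝ → M) (J : Set ℝ) : Prop :=
  ContMDiffOn 𝓘(ℝ, ℝ) I 2 γ J ∧
  ∀ s ∈ J,
    let c : ℝ → F := fun r => extChartAt I (γ s) (γ r)
    deriv (deriv c) s +
      christoffel (chartMetric I g (γ s)) (c s) (deriv c s) (deriv c s) = 0

/-- Lightlike tangent vectors (which are non-zero). -/
def IsLightlike (g : ∀ q : M, TangentSpace I q →L[ℝ] TangentSpace I q →L[ℝ] ℝ)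
    (z : M) (v : TangentSpace I z) : Prop :=
  v ≠ 0 ∧ g z v v = 0

/-- `φ` is a `C²` function on the open set `U` with `φ⁻¹(0) = U ∩ N` and `dφ ≠ 0` along `U ∩ N`.
In particular the tangent space of `N` at a point `z` of `U ∩ N` is the kernel of `dφ` at `z`, and
the two sides of `N` in `U` are `φ > 0` and `φ < 0`. -/
structure IsLocalDefiningFunction (N U : Set M) (φ : M → ℝ) : Prop where
  isOpen : IsOpen U
  contMDiffOn : ContMDiffOn I 𝓘(ℝ, ℝ) 2 φ U
  eq_zero_iff : ∀ z ∈ U, φ z = 0 ↔ z ∈ N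
  mfderiv_ne_zero : ∀ z ∈ U ∩ N, mfderiv I 𝓘(ℝ, ℝ) φ z ≠ 0

/-- `N` is an embedded hypersurface of class `C²`: locally the zero set of a `C²` function with
non-vanishing differential. -/
def IsC2Hypersurface (N : Set M) : Prop :=
  ∀ z ∈ N, ∃ (U : Set M) (φ : M → ℝ), z ∈ U ∧ IsLocalDefiningFunction I N U φ

/-- The infinitesimal condition along `U ∩ N` for the local defining function `φ`: its Hessian is
non-positive on the lightlike vectors tangent to `N`. -/
def InfLightConvexFor (g : ∀ q : M, TangentSpace I q →L[ℝ] TangentSpace I q →L[ℝ] ℝ)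
    (N U : Set M) (φ : M → ℝ) : Prop :=
  ∀ z ∈ U ∩ N, ∀ v : TangentSpace I z, IsLightlike I g z v →
    mfderiv I 𝓘(ℝ, ℝ) φ z v = 0 → hessian I g φ z v ≤ 0

/-- The local condition along `U ∩ N` for the local defining function `φ`, with `φ ≤ 0` (the closure
of the side `φ < 0` in `U`) as local exterior: every `z` in `U ∩ N` has a neighbourhood `V` such
that all lightlike geodesics in `V` which pass through `z` and are tangent to `N` there lie in the
local exterior. -/
def LocLightConvexFor (g : ∀ q : M, TangentSpace I q →L[ℝ] TangentSpace I q →L[ℝ] ℝ)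
    (N U : Set M) (φ : M → ℝ) : Prop :=
  ∀ z ∈ U ∩ N, ∃ V : Set M, IsOpen V ∧ z ∈ V ∧ V ⊆ U ∧
    ∀ (a b : ℝ) (γ : ℝ → M), a < 0 → 0 < b → γ 0 = z →
      IsGeodesicOn I g γ (Ioo a b) →
      (∀ s ∈ Ioo a b, IsLightlike I g (γ s) (velocity I γ s)) →
      mfderiv I 𝓘(ℝ, ℝ) φ (γ 0) (velocity I γ 0) = 0 →
      (∀ s ∈ Ioo a b, γ s ∈ V) →
      ∀ s ∈ Ioo a b, φ (γ s) ≤ 0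

/-- The hypersurface `N` is infinitesimally light-convex. -/
def InfLightConvex (g : ∀ q : M, TangentSpace I q →L[ℝ] TangentSpace I q →L[ℝ] ℝ)
    (N : Set M) : Prop :=
  ∀ z ∈ N, ∃ (U : Set M) (φ : M → ℝ), z ∈ U ∧
    IsLocalDefiningFunction I N U φ ∧ InfLightConvexFor I g N U φ

/-- The hypersurface `N` is locally light-convex. -/
def LocLightConvex (g : ∀ q : M, TangentSpace I q →L[ℝ] TangentSpace I q →L[ℝ] ℝ)
    (N : Set M) : Prop :=
  ∀ z ∈ N, ∃ (U : Set M) (φ : M → ℝ), z ∈ U ∧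
    IsLocalDefiningFunction I N U φ ∧ LocLightConvexFor I g N U φ

end General

/-! ### Standard stationary spacetimes -/

section Stationary

variable (E : Type*) [NormedAddCommGroup E] [NormedSpace ℝ E]
  (S : Type*) [TopologicalSpace S] [ChartedSpace E S] [IsManifold 𝓘(ℝ, E) ∞ S]

/-- The data of a standard stationary metric on `S × ℝ`: a smooth Riemannian metric `g₀`, a smooth
one-form `ω₀` and a smooth positive function `β` on `S`. -/
structure StationaryData where
  /-- the Riemannian metric on `S` -/
  g₀ : Bundle.ContMDiffRiemannianMetric 𝓘(ℝ, E) ∞ E (TangentSpace 𝓘(ℝ, E) : S → Type _)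
  /-- the one-form on `S` -/
  ω₀ : ∀ x : S, TangentSpace 𝓘(ℝ, E) x →L[ℝ] ℝ
  ω₀_smooth : ContMDiff 𝓘(ℝ, E) (𝓘(ℝ, E).prod 𝓘(ℝ, E →L[ℝ] ℝ)) ∞
    (fun x => Bundle.TotalSpace.mk' (E →L[ℝ] ℝ)
      (E := fun x : S => TangentSpace 𝓘(ℝ, E) x →L[ℝ] ℝ) x (ω₀ x))
  /-- the lapse function on `S` -/
  β : S → ℝ
  β_smooth : ContMDiff 𝓘(ℝ, E) 𝓘(ℝ, ℝ) ∞ β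
  β_pos : ∀ x, 0 < β x

variable {E S}

/-- The metric
`g_L ((y, τ), (y', τ')) = g₀ (y, y') + ω₀ (y) τ' + ω₀ (y') τ - β τ τ'` on `S × ℝ`. -/
def StationaryData.metric (A : StationaryData E S) (p : S × ℝ) :
    TangentSpace (𝓘(ℝ, E).prod 𝓘(ℝ, ℝ)) p →L[ℝ]
      TangentSpace (𝓘(ℝ, E).prod 𝓘(ℝ, ℝ)) p →L[ℝ] ℝ :=
  let dx : TangentSpace (𝓘(ℝ, E).prod 𝓘(ℝ, ℝ)) p →L[ℝ] TangentSpace 𝓘(ℝ, E) p.1 :=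
    mfderiv (𝓘(ℝ, E).prod 𝓘(ℝ, ℝ)) 𝓘(ℝ, E) Prod.fst p
  let dt : TangentSpace (𝓘(ℝ, E).prod 𝓘(ℝ, ℝ)) p →L[ℝ] ℝ :=
    mfderiv (𝓘(ℝ, E).prod 𝓘(ℝ, ℝ)) 𝓘(ℝ, ℝ) Prod.snd p
  let α := (A.ω₀ p.1).comp dx
  (ContinuousLinearMap.precomp ℝ dx).comp ((A.g₀.inner p.1).comp dx)
    + α.smulRight dt + dt.smulRight α - A.β p.1 • dt.smulRight dt

theorem StationaryData.metric_apply_self (A : StationaryData E S) (x : S) (t : ℝ)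
    (y : TangentSpace 𝓘(ℝ, E) x) (τ : ℝ) :
    A.metric (x, t) ((y, τ) : E × ℝ) ((y, τ) : E × ℝ)
      = A.g₀.inner x y y + 2 * A.ω₀ x y * τ - A.β x * τ ^ 2 := by
  have h1 : mfderiv (𝓘(ℝ, E).prod 𝓘(ℝ, ℝ)) 𝓘(ℝ, E) (Prod.fst : S × ℝ → S) (x, t)
      = ContinuousLinearMap.fst ℝ E ℝ := mfderiv_fst
  have h2 : mfderiv (𝓘(ℝ, E).prod 𝓘(ℝ, ℝ)) 𝓘(ℝ, ℝ) (Prod.snd : S × ℝ → ℝ) (x, t)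
      = ContinuousLinearMap.snd ℝ E ℝ := mfderiv_snd
  simp only [StationaryData.metric]
  rw [h1, h2]
  change A.g₀.inner x y y + A.ω₀ x y * τ + τ * A.ω₀ x y - A.β x * (τ * τ) = _
  ring

end Stationary

end LightConvexity

end

noncomputable section

set_option maxSynthPendingDepth 3

namespace LightConvexity

/-! ### Coordinate calculus: Christoffel symbols, energy, the geodesic flow -/

section Calculus

variable {X : Type*} [NormedAddCommGroup X] [NormedSpace ℝ X]

/-! From local to infinitesimal: if the Hessian is positive on a lightlike tangent `v`, shoot the
geodesic with velocity `v`. It stays lightlike because energy is conserved, and the geodesic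
equation turns the second derivative of `φ ∘ γ` at `0` into that Hessian. So `φ ∘ γ` starts with
value and slope zero and positive second derivative, which is incompatible with `φ ≤ 0`
(`LocLightConvexFor.infLightConvexFor`).

The converse is the delicate direction: the Hessian is controlled only on the hypersurface and only
on lightlike tangent vectors, while the geodesic leaves the hypersurface. In a chart, choose a
spatial `N` with `df N = 1` at the base point and let `ρ` be the displacement along `N` that carries
the geodesic `c` to `p = c + ρ N` in `{f = 0}`. Differentiating `f ∘ p = 0` twice expresses `-ρ''
df(N)` as an approximate Hessian at `p'`. This vector is tangent but only nearly lightlike. Since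
`∂_t` is tangent to `H`, altering the time component of `p'` keeps it tangent, and solving a
quadratic equation makes it exactly lightlike. The errors are linear in `ρ` and `ρ'`, whence `-ρ'' ≤
C (|ρ| τ² + |ρ'| |τ|)` with `τ` the time component of the velocity (`hessian_almost_nonpos`).

A lightlike vector is dominated by its time component, so `t` is a parameter along the geodesic.
Measuring in `t` makes the estimate independent of the affine parametrization, and one neighbourhood
serves all geodesics. As `ρ` and `ρ'` vanish at `0`, the maximum principle
`nonpos_of_second_order_ineq` applied to `-ρ` gives `ρ ≥ 0`; because `f` increases along `N`, this
means `f ∘ c ≤ 0` (`exists_ball_lightlike_geodesic_nonpos`).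

The rest is chart invariance of the Hessian and of the geodesic equation, and the verification that
the stationary metric fits the coordinate hypotheses. -/

theorem christoffelFirst_apply (G : X → X →L[ℝ] X →L[ℝ] ℝ) (e u v w : X) :
    christoffelFirst G e u v w =
      (fderiv ℝ G e u v w + fderiv ℝ G e v u w - fderiv ℝ G e w u v) / 2 := by
  simp [christoffelFirst]
  ring

theorem metric_christoffel {G : X → X →L[ℝ] X →L[ℝ] ℝ} {e : X} (h : (G e).IsInvertible)
    (u v w : X) : G e (christoffel G e u v) w = christoffelFirst G e u v w := by
  rw [christoffel, h.self_apply_inverse]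

/-- The transformation law of the Christoffel symbols under a change of coordinates `ψ`. -/
theorem fderiv_christoffel {G₁ G₂ : X → X →L[ℝ] X →L[ℝ] ℝ} {ψ : X → X} {e : X}
    (hψ : ContDiffAt ℝ 2 ψ e) (hG₁ : DifferentiableAt ℝ G₁ e)
    (hG₂ : DifferentiableAt ℝ G₂ (ψ e))
    (h : ∀ᶠ x in 𝓝 e, ∀ u v, G₁ x u v = G₂ (ψ x) (fderiv ℝ ψ x u) (fderiv ℝ ψ x v))
    (hsymm : ∀ u v, G₂ (ψ e) u v = G₂ (ψ e) v u)
    (inv₁ : (G₁ e).IsInvertible) (inv₂ : (G₂ (ψ e)).IsInvertible)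
    (hsurj : Function.Surjective (fderiv ℝ ψ e)) (u v : X) :
    fderiv ℝ ψ e (christoffel G₁ e u v) = fderiv ℝ (fderiv ℝ ψ) e u v +
      christoffel G₂ (ψ e) (fderiv ℝ ψ e u) (fderiv ℝ ψ e v) := by
  have hψ1 : HasFDerivAt ψ (fderiv ℝ ψ e) e := (hψ.differentiableAt (by simp)).hasFDerivAt
  have hψ2 : HasFDerivAt (fderiv ℝ ψ) (fderiv ℝ (fderiv ℝ ψ) e) e :=
    ((hψ.fderiv_right (m := 1) (by norm_num)).differentiableAt (by simp)).hasFDerivAt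
  have hs : ∀ a b, fderiv ℝ (fderiv ℝ ψ) e a b = fderiv ℝ (fderiv ℝ ψ) e b a :=
    fun a b => (hψ.isSymmSndFDerivAt (by simp)) a b
  have key : ∀ a b c, fderiv ℝ G₁ e a b c =
      fderiv ℝ G₂ (ψ e) (fderiv ℝ ψ e a) (fderiv ℝ ψ e b) (fderiv ℝ ψ e c) +
      G₂ (ψ e) (fderiv ℝ (fderiv ℝ ψ) e a b) (fderiv ℝ ψ e c) +
      G₂ (ψ e) (fderiv ℝ ψ e b) (fderiv ℝ (fderiv ℝ ψ) e a c) := by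
    intro a b c
    have h1 : HasFDerivAt (fun x => G₁ x b c) _ e :=
      (hG₁.hasFDerivAt.clm_apply (hasFDerivAt_const b e)).clm_apply (hasFDerivAt_const c e)
    have h2 : HasFDerivAt (fun x => G₂ (ψ x) (fderiv ℝ ψ x b) (fderiv ℝ ψ x c)) _ e :=
      ((hG₂.hasFDerivAt.comp e hψ1).clm_apply
        (hψ2.clm_apply (hasFDerivAt_const b e))).clm_apply
          (hψ2.clm_apply (hasFDerivAt_const c e))
    have h3 := h1.unique (h2.congr_of_eventuallyEq (h.mono fun x hx => hx b c))
    have h4 := congrArg (fun L : X →L[ℝ] ℝ => L a) h3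
    simp at h4
    rw [h4]; ring
  -- Compare after lowering the index with `G₂` and pairing with vectors `dψ w`, which exhaust the
  -- space by surjectivity; `key` then reduces the claim to the symmetry of `D²ψ` and of `G₂`.
  have inj : Function.Injective (G₂ (ψ e)) := inv₂.injective
  apply inj
  ext w'
  obtain ⟨w, rfl⟩ := hsurj w'
  rw [← h.self_of_nhds, metric_christoffel inv₁, map_add, add_apply,
    metric_christoffel inv₂, christoffelFirst_apply, christoffelFirst_apply, key, key, key,
    hs v u, hs w u, hs w v, hsymm (fderiv ℝ (fderiv ℝ ψ) e u w)]
  ring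

/-- The Christoffel symbols as a bilinear map. -/
def christoffelBilin (G : X → X →L[ℝ] X →L[ℝ] ℝ) (e : X) : X →L[ℝ] X →L[ℝ] X :=
  (ContinuousLinearMap.compL ℝ X (X →L[ℝ] ℝ) X (G e).inverse).comp
    ((1 / 2 : ℝ) • (fderiv ℝ G e + (fderiv ℝ G e).flip -
      (ContinuousLinearMap.flipₗᵢ ℝ X X ℝ).toContinuousLinearEquiv.toContinuousLinearMap.comp
        (fderiv ℝ G e).flip))

theorem christoffelBilin_apply (G : X → X →L[ℝ] X →L[ℝ] ℝ) (e u v : X) :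
    christoffelBilin G e u v = christoffel G e u v := by
  rfl

/-- The symbols lose one derivative of `G`. Being `C¹` supplies both the Lipschitz bound used in the
estimates and the hypothesis of Picard–Lindelöf. -/
theorem contDiffAt_christoffelBilin [CompleteSpace X] {G : X → X →L[ℝ] X →L[ℝ] ℝ} {e : X}
    (hG : ContDiffAt ℝ 2 G e) (inv : (G e).IsInvertible) :
    ContDiffAt ℝ 1 (christoffelBilin G) e := by
  have h1 : ContDiffAt ℝ 1 (fun x => (G x).inverse) e :=
    inv.contDiffAt_map_inverse.comp e (hG.of_le (by norm_num))
  have h2 : ContDiffAt ℝ 1 (fderiv ℝ G) e := hG.fderiv_right (by norm_num)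
  have h3 : ContDiffAt ℝ 1 (fun x => (fderiv ℝ G x).flip) e :=
    (ContinuousLinearMap.flipₗᵢ ℝ X X (X →L[ℝ] ℝ)).toContinuousLinearEquiv.contDiff.contDiffAt.comp
      e h2
  have h4 : ContDiffAt ℝ 1 (fun x => ContinuousLinearMap.compL ℝ X (X →L[ℝ] ℝ) X (G x).inverse) e :=
    (ContinuousLinearMap.compL ℝ X (X →L[ℝ] ℝ) X).contDiff.contDiffAt.comp e h1
  exact h4.clm_comp (((h2.add h3).sub (contDiffAt_const.clm_comp h3)).const_smul _)

/-- The second derivative of a function along a curve. -/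
theorem hasDerivAt_fderiv_apply {Y : Type*} [NormedAddCommGroup Y] [NormedSpace ℝ Y] {f : X → Y}
    {c c₁ : ℝ → X} {s : ℝ} {c₂ : X} (hf : ContDiffAt ℝ 2 f (c s)) (h₁ : HasDerivAt c (c₁ s) s)
    (h₂ : HasDerivAt c₁ c₂ s) :
    HasDerivAt (fun r => fderiv ℝ f (c r) (c₁ r))
      (fderiv ℝ (fderiv ℝ f) (c s) (c₁ s) (c₁ s) + fderiv ℝ f (c s) c₂) s := by
  have hf2 : HasFDerivAt (fderiv ℝ f) (fderiv ℝ (fderiv ℝ f) (c s)) (c s) :=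
    ((hf.fderiv_right (m := 1) (by norm_num)).differentiableAt (by simp)).hasFDerivAt
  exact (hf2.comp_hasDerivAt s h₁).clm_apply h₂

theorem hasDerivAt_comp_curve {Y : Type*} [NormedAddCommGroup Y] [NormedSpace ℝ Y] {f : X → Y}
    {c : ℝ → X} {s : ℝ} {c₁ : X} (hf : DifferentiableAt ℝ f (c s)) (h₁ : HasDerivAt c c₁ s) :
    HasDerivAt (fun r => f (c r)) (fderiv ℝ f (c s) c₁) s :=
  hf.hasFDerivAt.comp_hasDerivAt s h₁

/-- The energy of a geodesic is constant. -/
theorem hasDerivAt_energy {G : X → X →L[ℝ] X →L[ℝ] ℝ} {c c₁ : ℝ → X} {s : ℝ}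
    (hG : DifferentiableAt ℝ G (c s)) (hsymm : ∀ u v, G (c s) u v = G (c s) v u)
    (inv : (G (c s)).IsInvertible) (h₁ : HasDerivAt c (c₁ s) s)
    (h₂ : HasDerivAt c₁ (-christoffel G (c s) (c₁ s) (c₁ s)) s) :
    HasDerivAt (fun r => G (c r) (c₁ r) (c₁ r)) 0 s := by
  have h := ((hG.hasFDerivAt.comp_hasDerivAt s h₁).clm_apply h₂).clm_apply h₂
  have e0 : (fderiv ℝ G (c s) (c₁ s) (c₁ s) + G (c s) (-christoffel G (c s) (c₁ s) (c₁ s))) (c₁ s) +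
      G (c s) (c₁ s) (-christoffel G (c s) (c₁ s) (c₁ s)) = 0 := by
    rw [hsymm (c₁ s), map_neg, add_apply, neg_apply, metric_christoffel inv,
      christoffelFirst_apply]
    ring
  exact h.congr_deriv e0

/-- Short time existence of geodesics in coordinates. -/
theorem exists_geodesic [CompleteSpace X] {G : X → X →L[ℝ] X →L[ℝ] ℝ} {e : X}
    (hG : ContDiffAt ℝ 2 G e) (inv : (G e).IsInvertible) (v : X) :
    ∃ c c₁ : ℝ → X, c 0 = e ∧ c₁ 0 = v ∧ ∃ ε > 0, ∀ s ∈ Ioo (-ε) ε,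
      HasDerivAt c (c₁ s) s ∧ HasDerivAt c₁ (-christoffel G (c s) (c₁ s) (c₁ s)) s := by
  -- The geodesic equation as a first-order autonomous system for position and velocity.
  let V : X × X → X × X := fun p => (p.2, -christoffelBilin G p.1 p.2 p.2)
  have hV : ContDiffAt ℝ 1 V (e, v) := by
    have hB : ContDiffAt ℝ 1 (fun p : X × X => christoffelBilin G p.1) (e, v) :=
      ContDiffAt.comp (e, v) (f := Prod.fst) (contDiffAt_christoffelBilin hG inv) contDiffAt_fst
    exact contDiffAt_snd.prodMk (((hB.clm_apply contDiffAt_snd).clm_apply contDiffAt_snd).neg)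
  obtain ⟨α, h0, ε, hε, h⟩ :=
    hV.exists_forall_mem_closedBall_exists_eq_forall_mem_Ioo_hasDerivAt₀ 0
  refine ⟨fun s => (α s).1, fun s => (α s).2, by simp [h0], by simp [h0], ε, hε, fun s hs => ?_⟩
  have := h s (by simpa using hs)
  refine ⟨this.fst, ?_⟩
  have h2 := this.snd
  simp only [V, christoffelBilin_apply] at h2
  exact h2

end Calculus

/-! ### A maximum principle for second-order differential inequalities -/

section Comparison

theorem sub_le_mul_sub_of_deriv_le {f f' g g' : ℝ → ℝ} {a b L : ℝ} (hab : a ≤ b)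
    (hf : ∀ s ∈ Icc a b, HasDerivAt f (f' s) s) (hg : ∀ s ∈ Icc a b, HasDerivAt g (g' s) s)
    (h : ∀ s ∈ Icc a b, f' s ≤ L * g' s) : f b - f a ≤ L * (g b - g a) := by
  have hd : ∀ s ∈ Icc a b, HasDerivAt (fun s => L * g s - f s) (L * g' s - f' s) s :=
    fun s hs => ((hg s hs).const_mul L).sub (hf s hs)
  have hm : MonotoneOn (fun s => L * g s - f s) (Icc a b) := by
    apply monotoneOn_of_deriv_nonneg (convex_Icc a b)
    · exact fun s hs => (hd s hs).continuousAt.continuousWithinAt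
    · exact fun s hs => (hd s (interior_subset hs)).differentiableAt.differentiableWithinAt
    · intro s hs
      rw [(hd s (interior_subset hs)).deriv]
      linarith [h s (interior_subset hs)]
  have := hm (left_mem_Icc.2 hab) (right_mem_Icc.2 hab) hab
  simp only at this
  linarith

theorem deriv_nonneg_of_forall_le {u : ℝ → ℝ} {u' a b : ℝ} (hab : a < b) (hu : HasDerivAt u u' b)
    (h : ∀ s ∈ Icc a b, u s ≤ u b) : 0 ≤ u' := by
  have h1 : Filter.Tendsto (slope u b) (𝓝[<] b) (𝓝 u') :=
    hu.tendsto_slope.mono_left (nhdsWithin_mono _ fun x hx => ne_of_lt hx)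
  refine ge_of_tendsto h1 ?_
  filter_upwards [Ioo_mem_nhdsLT hab] with s hs
  rw [slope_def_field]
  exact div_nonneg_of_nonpos (by linarith [h s ⟨hs.1.le, hs.2.le⟩]) (by linarith [hs.2])

/-- A maximum principle for `u'' ≤ C (|u| τ² + |u'| τ)` with vanishing initial data, on an interval
that is short when measured with the density `τ = t'`. -/
theorem nonpos_of_second_order_ineq {u u₁ u₂ t τ τ₁ : ℝ → ℝ} {T C ε : ℝ} (hT : 0 ≤ T) (hC : 0 ≤ C)
    (hε : C * (ε + 2) * ε < 1)
    (hu : ∀ s ∈ Icc 0 T, HasDerivAt u (u₁ s) s) (hu₁ : ∀ s ∈ Icc 0 T, HasDerivAt u₁ (u₂ s) s)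
    (ht : ∀ s ∈ Icc 0 T, HasDerivAt t (τ s) s) (hτ : ∀ s ∈ Icc 0 T, HasDerivAt τ (τ₁ s) s)
    (hpos : ∀ s ∈ Icc 0 T, 0 < τ s) (hτ₁ : ∀ s ∈ Icc 0 T, |τ₁ s| ≤ C * τ s ^ 2)
    (hu₂ : ∀ s ∈ Icc 0 T, u₂ s ≤ C * (|u s| * τ s ^ 2 + |u₁ s| * τ s))
    (htT : t T - t 0 ≤ ε) (h0 : u 0 = 0) (h1 : u₁ 0 = 0) : u T ≤ 0 := by
  by_contra! hcon
  have hcont : ContinuousOn u (Icc 0 T) := fun s hs => (hu s hs).continuousAt.continuousWithinAt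
  -- The hypothesis bounds `u''` only from above, so a very negative slope must be excluded
  -- separately. Stopping at a maximum of `u` does this: the slope there is non-negative.
  obtain ⟨s₁, hs₁, hmax⟩ := isCompact_Icc.exists_isMaxOn (nonempty_Icc.2 hT) hcont
  have hus₁ : 0 < u s₁ := hcon.trans_le (hmax (right_mem_Icc.2 hT))
  have hs₁0 : 0 < s₁ := lt_of_le_of_ne hs₁.1 (by rintro rfl; linarith)
  have hsub : Icc 0 s₁ ⊆ Icc 0 T := Icc_subset_Icc_right hs₁.2
  have hder : 0 ≤ u₁ s₁ :=
    deriv_nonneg_of_forall_le hs₁0 (hu s₁ hs₁) fun s hs => hmax (hsub hs)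
  have hmono : ∀ a b, 0 ≤ a → a ≤ b → b ≤ T → 0 ≤ t b - t a := by
    intro a b ha hab hb
    have := sub_le_mul_sub_of_deriv_le (f := fun _ => (0 : ℝ)) (f' := fun _ => 0) (L := 1) hab
      (fun s _ => hasDerivAt_const s 0) (fun s hs => ht s ⟨ha.trans hs.1, hs.2.trans hb⟩)
      (fun s hs => by linarith [hpos s ⟨ha.trans hs.1, hs.2.trans hb⟩])
    linarith
  -- `q` is the slope `du/dt`, insensitive to reparametrization.
  set q : ℝ → ℝ := fun s => u₁ s / τ s with hq
  have hqd : ∀ s ∈ Icc 0 T, HasDerivAt q ((u₂ s * τ s - u₁ s * τ₁ s) / τ s ^ 2) s :=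
    fun s hs => (hu₁ s hs).div (hτ s hs) (hpos s hs).ne'
  have hqc : ContinuousOn (fun s => |q s|) (Icc 0 s₁) :=
    fun s hs => (hqd s (hsub hs)).continuousAt.continuousWithinAt.abs
  obtain ⟨r, hr, hrmax⟩ := isCompact_Icc.exists_isMaxOn (nonempty_Icc.2 hs₁0.le) hqc
  set N := |q r| with hN
  have hN0 : 0 ≤ N := abs_nonneg _
  have hu₁N : ∀ s ∈ Icc 0 s₁, |u₁ s| ≤ N * τ s := by
    intro s hs
    have h2 : |q s| ≤ N := hrmax hs
    have hp := hpos s (hsub hs)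
    rwa [hq, abs_div, abs_of_pos hp, div_le_iff₀ hp] at h2
  have hεs : ∀ s ∈ Icc 0 s₁, t s - t 0 ≤ ε := fun s hs => by
    linarith [hmono s T hs.1 (hsub hs).2 le_rfl]
  have hε0 : 0 ≤ ε := by linarith [hmono 0 T le_rfl hT le_rfl]
  have huN' : ∀ s ∈ Icc 0 s₁, |u s| ≤ N * (t s - t 0) := by
    intro s hs
    have e1 := sub_le_mul_sub_of_deriv_le (L := N) hs.1
      (fun r hr => hu r (hsub ⟨hr.1, hr.2.trans hs.2⟩))
      (fun r hr => ht r (hsub ⟨hr.1, hr.2.trans hs.2⟩))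
      (fun r hr => (le_abs_self _).trans (hu₁N r ⟨hr.1, hr.2.trans hs.2⟩))
    have e2 := sub_le_mul_sub_of_deriv_le (L := N) hs.1
      (fun r hr => (hu r (hsub ⟨hr.1, hr.2.trans hs.2⟩)).neg)
      (fun r hr => ht r (hsub ⟨hr.1, hr.2.trans hs.2⟩))
      (fun r hr => (neg_le_abs _).trans (hu₁N r ⟨hr.1, hr.2.trans hs.2⟩))
    simp only [Pi.neg_apply, h0] at e1 e2
    exact abs_le.2 ⟨by linarith, by linarith⟩
  have huN : ∀ s ∈ Icc 0 s₁, |u s| ≤ N * ε := fun s hs =>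
    (huN' s hs).trans (mul_le_mul_of_nonneg_left (hεs s hs) hN0)
  have hq' : ∀ s ∈ Icc 0 s₁,
      (u₂ s * τ s - u₁ s * τ₁ s) / τ s ^ 2 ≤ (C * N * (ε + 2)) * τ s := by
    intro s hs
    have hp := hpos s (hsub hs)
    rw [div_le_iff₀ (by positivity)]
    have a1 : u₂ s * τ s ≤ C * (N * ε * τ s ^ 2 + N * τ s * τ s) * τ s := by
      apply mul_le_mul_of_nonneg_right _ hp.le
      refine (hu₂ s (hsub hs)).trans (mul_le_mul_of_nonneg_left ?_ hC)
      gcongr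
      exacts [huN s hs, hu₁N s hs]
    have a2 : -(u₁ s * τ₁ s) ≤ (N * τ s) * (C * τ s ^ 2) := by
      refine (neg_le_abs _).trans ?_
      rw [abs_mul]
      exact mul_le_mul (hu₁N s hs) (hτ₁ s (hsub hs)) (abs_nonneg _) (by positivity)
    nlinarith
  have hqq : ∀ a b, 0 ≤ a → a ≤ b → b ≤ s₁ → q b - q a ≤ C * N * (ε + 2) * ε := by
    intro a b ha hab hb
    refine (sub_le_mul_sub_of_deriv_le hab
      (fun s hs => hqd s (hsub ⟨ha.trans hs.1, hs.2.trans hb⟩))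
      (fun s hs => ht s (hsub ⟨ha.trans hs.1, hs.2.trans hb⟩))
      (fun s hs => hq' s ⟨ha.trans hs.1, hs.2.trans hb⟩)).trans ?_
    apply mul_le_mul_of_nonneg_left _ (by positivity)
    linarith [hmono 0 a le_rfl ha (hab.trans (hb.trans hs₁.2)), hεs b ⟨ha.trans hab, hb⟩]
  have hNpos : N = 0 := by
    by_contra hne
    have hNp : 0 < N := lt_of_le_of_ne hN0 (Ne.symm hne)
    have hlt : C * N * (ε + 2) * ε < N := by nlinarith
    have hq0 : q 0 = 0 := by simp [hq, h1]
    have hqs₁ : 0 ≤ q s₁ := div_nonneg hder (hpos s₁ hs₁).le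
    -- If `q r = N`, the rise over `[0, r]` is `N`; if `q r = -N`, the rise over `[r, s₁]` is at
    -- least `N`. Both exceed the permitted rise.
    have c1 := hqq 0 r le_rfl hr.1 hr.2
    have c2 := hqq r s₁ hr.1 hr.2 le_rfl
    rcases abs_cases (q r) with h | h <;> linarith [h.1]
  have := huN s₁ (right_mem_Icc.2 hs₁0.le)
  rw [hNpos, zero_mul] at this
  linarith [le_abs_self (u s₁)]

/-- A continuous `τ` without zeros has constant sign; when it is negative, replace `t` by `-t`.
Past-directed geodesics are thereby included. -/
theorem nonpos_of_second_order_ineq_right {u u₁ u₂ t τ τ₁ : ℝ → ℝ} {T C ε : ℝ} (hT : 0 ≤ T)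
    (hC : 0 ≤ C) (hε : C * (ε + 2) * ε < 1)
    (hu : ∀ s ∈ Icc 0 T, HasDerivAt u (u₁ s) s) (hu₁ : ∀ s ∈ Icc 0 T, HasDerivAt u₁ (u₂ s) s)
    (ht : ∀ s ∈ Icc 0 T, HasDerivAt t (τ s) s) (hτ : ∀ s ∈ Icc 0 T, HasDerivAt τ (τ₁ s) s)
    (hne : ∀ s ∈ Icc 0 T, τ s ≠ 0) (hτ₁ : ∀ s ∈ Icc 0 T, |τ₁ s| ≤ C * τ s ^ 2)
    (hu₂ : ∀ s ∈ Icc 0 T, u₂ s ≤ C * (|u s| * τ s ^ 2 + |u₁ s| * |τ s|))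
    (htT : |t T - t 0| ≤ ε) (h0 : u 0 = 0) (h1 : u₁ 0 = 0) : u T ≤ 0 := by
  have hτc : ContinuousOn τ (Icc 0 T) := fun s hs => (hτ s hs).continuousAt.continuousWithinAt
  rcases lt_or_gt_of_ne (hne 0 (left_mem_Icc.2 hT)) with h | h
  · have hneg : ∀ s ∈ Icc 0 T, τ s < 0 := by
      intro s hs
      by_contra! hs'
      obtain ⟨r, hr, hr0⟩ := intermediate_value_Icc hs.1
        (hτc.mono (Icc_subset_Icc_right hs.2)) ⟨h.le, hs'⟩
      exact hne r ⟨hr.1, hr.2.trans hs.2⟩ hr0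
    refine nonpos_of_second_order_ineq (t := fun s => -t s) (τ := fun s => -τ s)
      (τ₁ := fun s => -τ₁ s) hT hC hε hu hu₁ (fun s hs => (ht s hs).neg) (fun s hs => (hτ s hs).neg)
      (fun s hs => by linarith [hneg s hs]) (fun s hs => ?_) (fun s hs => ?_) ?_ h0 h1
    · simpa using hτ₁ s hs
    · simpa [abs_of_neg (hneg s hs)] using hu₂ s hs
    · linarith [neg_abs_le (t T - t 0)]
  · have hpos : ∀ s ∈ Icc 0 T, 0 < τ s := by
      intro s hs
      by_contra! hs'
      obtain ⟨r, hr, hr0⟩ := intermediate_value_Icc' hs.1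
        (hτc.mono (Icc_subset_Icc_right hs.2)) ⟨hs', h.le⟩
      exact hne r ⟨hr.1, hr.2.trans hs.2⟩ hr0
    refine nonpos_of_second_order_ineq hT hC hε hu hu₁ ht hτ hpos hτ₁ (fun s hs => ?_)
      ((le_abs_self _).trans htT) h0 h1
    simpa [abs_of_pos (hpos s hs)] using hu₂ s hs

/-- Reversal `s ↦ -s` handles negative parameters: it preserves `u₂` and `τ₁` and flips `u₁` and
`τ`, which enter the bounds only through absolute values or squares. -/
theorem nonpos_of_second_order_ineq_Ioo {u u₁ u₂ t τ τ₁ : ℝ → ℝ} {a b C ε : ℝ} (ha : a < 0)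
    (hb : 0 < b) (hC : 0 ≤ C) (hε : C * (ε + 2) * ε < 1)
    (hu : ∀ s ∈ Ioo a b, HasDerivAt u (u₁ s) s) (hu₁ : ∀ s ∈ Ioo a b, HasDerivAt u₁ (u₂ s) s)
    (ht : ∀ s ∈ Ioo a b, HasDerivAt t (τ s) s) (hτ : ∀ s ∈ Ioo a b, HasDerivAt τ (τ₁ s) s)
    (hne : ∀ s ∈ Ioo a b, τ s ≠ 0) (hτ₁ : ∀ s ∈ Ioo a b, |τ₁ s| ≤ C * τ s ^ 2)
    (hu₂ : ∀ s ∈ Ioo a b, u₂ s ≤ C * (|u s| * τ s ^ 2 + |u₁ s| * |τ s|))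
    (htT : ∀ s ∈ Ioo a b, |t s - t 0| ≤ ε) (h0 : u 0 = 0) (h1 : u₁ 0 = 0) :
    ∀ s ∈ Ioo a b, u s ≤ 0 := by
  intro T hT
  rcases le_total 0 T with h | h
  · have hs : ∀ s ∈ Icc 0 T, s ∈ Ioo a b := fun s hs => ⟨ha.trans_le hs.1, hs.2.trans_lt hT.2⟩
    exact nonpos_of_second_order_ineq_right h hC hε (fun s h => hu s (hs s h))
      (fun s h => hu₁ s (hs s h)) (fun s h => ht s (hs s h)) (fun s h => hτ s (hs s h))
      (fun s h => hne s (hs s h)) (fun s h => hτ₁ s (hs s h)) (fun s h => hu₂ s (hs s h))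
      (htT T hT) h0 h1
  · have hs : ∀ s ∈ Icc 0 (-T), -s ∈ Ioo a b := fun s hs =>
      ⟨by linarith [hs.2, hT.1], by linarith [hs.1]⟩
    have hn : ∀ s : ℝ, HasDerivAt (fun r : ℝ => -r) (-1) s := fun s => hasDerivAt_neg s
    have key := nonpos_of_second_order_ineq_right (T := -T) (C := C) (ε := ε)
      (u := fun s => u (-s)) (u₁ := fun s => -u₁ (-s)) (u₂ := fun s => u₂ (-s))
      (t := fun s => t (-s)) (τ := fun s => -τ (-s)) (τ₁ := fun s => τ₁ (-s)) (by linarith) hC hε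
      (fun s h => ((hu _ (hs s h)).comp s (hn s)).congr_deriv (by ring))
      (fun s h => ((hu₁ _ (hs s h)).comp s (hn s)).neg.congr_deriv (by ring))
      (fun s h => ((ht _ (hs s h)).comp s (hn s)).congr_deriv (by ring))
      (fun s h => ((hτ _ (hs s h)).comp s (hn s)).neg.congr_deriv (by ring))
      (fun s h => by simpa using hne _ (hs s h)) (fun s h => by simpa using hτ₁ _ (hs s h))
      (fun s h => by simpa using hu₂ _ (hs s h)) (by simpa using htT T hT) (by simpa using h0)
      (by simpa using h1)
    simpa using key

end Comparison

/-! ### Algebraic estimates: approximate roots and bilinear maps -/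

section Estimates

/-- A root of a quadratic polynomial close to an approximate root. -/
theorem exists_root_near {P W β τ : ℝ} (hβ : 0 < β) (hP : 0 ≤ P) :
    ∃ σ, P + 2 * W * σ - β * σ ^ 2 = 0 ∧
      β * |τ| * |σ - τ| ≤ |P + 2 * W * τ - β * τ ^ 2| := by
  set D := √(W ^ 2 + β * P) with hD
  have hD2 : D ^ 2 = W ^ 2 + β * P := Real.sq_sqrt (by positivity)
  have hD0 : 0 ≤ D := Real.sqrt_nonneg _
  have hWD : |W| ≤ D := abs_le_of_sq_le_sq (by nlinarith [mul_nonneg hβ.le hP]) hD0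
  -- The sign `δ` selects the root `(W + δ D) / β` lying on the same side of the vertex `W / β` as
  -- `τ`.
  have main : ∀ δ : ℝ, δ ^ 2 = 1 → 0 ≤ δ * (β * τ - W) →
      ∃ σ, P + 2 * W * σ - β * σ ^ 2 = 0 ∧
        β * |τ| * |σ - τ| ≤ |P + 2 * W * τ - β * τ ^ 2| := by
    intro δ hδ ha
    set α := δ * (β * τ - W) with hα
    have hα' : β * τ - W = δ * α := by rw [hα, ← mul_assoc, ← sq, hδ, one_mul]
    refine ⟨(W + δ * D) / β, ?_, ?_⟩
    · field_simp
      linear_combination (-1 : ℝ) * hD2 * 1 + (-(D ^ 2)) * hδ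
    · have hδ1 : |δ| = 1 := by
        rw [← sq_abs] at hδ
        nlinarith [abs_nonneg δ]
      have e1 : (W + δ * D) / β - τ = δ * (D - α) / β := by
        field_simp
        linear_combination -hα'
      -- The defect factors over the two roots: one factor measures `σ - τ`, the other is at least
      -- `β |τ|` by `e3`.
      have e2 : P + 2 * W * τ - β * τ ^ 2 = (D - α) * (D + α) / β := by
        have : α ^ 2 = (β * τ - W) ^ 2 := by
          linear_combination (-(β * τ - W) - δ * α) * hα' - α ^ 2 * hδ
        field_simp
        linear_combination (-1 : ℝ) * hD2 + this
      have e3 : β * |τ| ≤ D + α := by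
        have : β * τ = W + δ * α := by linarith
        calc β * |τ| = |β * τ| := by rw [abs_mul, abs_of_pos hβ]
          _ ≤ |W| + |δ * α| := this ▸ abs_add_le _ _
          _ ≤ D + α := by
            rw [abs_mul, hδ1, one_mul, abs_of_nonneg ha]; linarith
      rw [e1, e2, abs_div, abs_div, abs_mul, abs_mul, hδ1, one_mul, abs_of_pos hβ,
        abs_of_nonneg (by linarith : 0 ≤ D + α), ← mul_div_assoc]
      gcongr ?_ / β
      rw [mul_comm]
      gcongr
  rcases le_total 0 (β * τ - W) with h | h
  · exact main 1 (by norm_num) (by linarith)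
  · exact main (-1) (by norm_num) (by linarith)

variable {X Y : Type*} [NormedAddCommGroup X] [NormedSpace ℝ X] [NormedAddCommGroup Y]
  [NormedSpace ℝ Y]

theorem norm_bilin_sub_le (B B' : X →L[ℝ] X →L[ℝ] Y) (v w : X) :
    ‖B' v v - B w w‖ ≤ ‖B' - B‖ * ‖w‖ ^ 2 + ‖B'‖ * (‖v‖ + ‖w‖) * ‖v - w‖ := by
  have e : B' v v - B w w = (B' - B) w w + (B' (v - w) w + B' v (v - w)) := by
    simp
  rw [e]
  refine (norm_add_le _ _).trans (add_le_add ?_ ((norm_add_le _ _).trans ?_))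
  · exact ((B' - B).le_opNorm₂ w w).trans_eq (by ring)
  · have h1 := B'.le_opNorm₂ (v - w) w
    have h2 := B'.le_opNorm₂ v (v - w)
    nlinarith

end Estimates

/-! ### The pointwise Hessian estimate -/

section PointEstimate

variable {E : Type*} [NormedAddCommGroup E] [NormedSpace ℝ E]

/-- Written as a quadratic in the time component, in the shape expected by `exists_root_near`. -/
theorem quadratic_expansion (g : E × ℝ →L[ℝ] E × ℝ →L[ℝ] ℝ) (hsymm : ∀ u v, g u v = g v u)
    (y : E) (σ : ℝ) :
    g (y, σ) (y, σ) = g (y, 0) (y, 0) + 2 * g (y, 0) (0, 1) * σ - (-g (0, 1) (0, 1)) * σ ^ 2 := by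
  have e : ((y, σ) : E × ℝ) = (y, 0) + σ • (0, 1) := by simp
  rw [e]
  simp only [map_add, map_smul, add_apply, smul_apply, smul_eq_mul]
  rw [hsymm (0, 1) (y, 0)]
  ring

/-- If the coordinate Hessian `S - ℓ ∘ Γ'` is non-positive on lightlike vectors tangent to
`ker ℓ`, then it is almost so when evaluated at an almost lightlike tangent vector, with Christoffel
symbols taken at a nearby point. -/
theorem hessian_almost_nonpos {K ρ ρ₁ : ℝ} (hK : 1 ≤ K) {g g' S : E × ℝ →L[ℝ] E × ℝ →L[ℝ] ℝ}
    {Γ Γ' : E × ℝ →L[ℝ] E × ℝ →L[ℝ] E × ℝ} {ℓ : E × ℝ →L[ℝ] ℝ} {N w : E × ℝ}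
    (hg' : ‖g'‖ ≤ K) (hgg : ‖g' - g‖ ≤ K * |ρ|) (hΓ' : ‖Γ'‖ ≤ K) (hΓΓ : ‖Γ' - Γ‖ ≤ K * |ρ|)
    (hℓ : ‖ℓ‖ ≤ K) (hS : ‖S‖ ≤ K) (hN : ‖N‖ ≤ K) (hρ : |ρ| ≤ 1) (hρ₁ : |ρ₁| ≤ K * ‖w‖)
    (hw : ‖w‖ ≤ K * |w.2|) (hw2 : w.2 ≠ 0) (hN2 : N.2 = 0) (hsymm : ∀ u v, g' u v = g' v u)
    (hpos : ∀ y : E, 0 ≤ g' (y, 0) (y, 0)) (hneg : 1 ≤ K * -g' (0, 1) (0, 1)) (hgw : g w w = 0)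
    (hℓw : ℓ (w + ρ₁ • N) = 0) (hℓT : ℓ (0, 1) = 0)
    (hess : ∀ v, v ≠ 0 → g' v v = 0 → ℓ v = 0 → S v v - ℓ (Γ' v v) ≤ 0) :
    S (w + ρ₁ • N) (w + ρ₁ • N) - ℓ (Γ w w) ≤ 100 * K ^ 16 * (|ρ| * w.2 ^ 2 + |ρ₁| * |w.2|) := by
  have hK0 : 0 < K := by linarith
  set t := |w.2| with ht
  have ht0 : 0 < t := abs_pos.2 hw2
  have htt : w.2 ^ 2 = t ^ 2 := (sq_abs _).symm
  set A := |ρ| with hA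
  set B := |ρ₁| with hB
  have hA0 : 0 ≤ A := abs_nonneg _
  have hB0 : 0 ≤ B := abs_nonneg _
  have pow_le : ∀ m n : ℕ, m ≤ n → K ^ m ≤ K ^ n := fun m n h => pow_le_pow_right₀ hK h
  set v := w + ρ₁ • N with hv
  have hvw : ‖v - w‖ ≤ K * B := by
    rw [hv, add_sub_cancel_left, norm_smul, Real.norm_eq_abs, mul_comm]; gcongr
  have hBt : B ≤ K ^ 2 * t := hρ₁.trans (by rw [sq, mul_assoc]; gcongr)
  have hvn : ‖v‖ ≤ 2 * K ^ 3 * t := by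
    calc ‖v‖ = ‖w + (v - w)‖ := by rw [add_sub_cancel]
      _ ≤ K * t + K * (K ^ 2 * t) := (norm_add_le _ _).trans (add_le_add hw (hvw.trans (by gcongr)))
      _ ≤ K ^ 3 * t + K * (K ^ 2 * t) := by
        gcongr; simpa using pow_le 1 3 (by norm_num)
      _ = _ := by ring
  have hwn : ‖w‖ ≤ K ^ 3 * t := hw.trans (by gcongr; simpa using pow_le 1 3 (by norm_num))
  have hv2 : v.2 = w.2 := by simp [hv, hN2]
  -- the defect of `v` from being lightlike
  have hQ : |g' v v| ≤ 4 * K ^ 5 * (A * t ^ 2 + B * t) := by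
    have h1 := norm_bilin_sub_le g g' v w
    rw [hgw, sub_zero, Real.norm_eq_abs] at h1
    refine h1.trans ?_
    calc ‖g' - g‖ * ‖w‖ ^ 2 + ‖g'‖ * (‖v‖ + ‖w‖) * ‖v - w‖
        ≤ K * A * (K * t) ^ 2 + K * (2 * K ^ 3 * t + K ^ 3 * t) * (K * B) := by gcongr
      _ = K ^ 3 * (A * t ^ 2) + 3 * K ^ 5 * (B * t) := by ring
      _ ≤ (4 * K ^ 5) * (A * t ^ 2) + (4 * K ^ 5) * (B * t) := by
        have := pow_le 3 5 (by norm_num)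
        have := pow_pos hK0 5
        gcongr <;> linarith
      _ = _ := by ring
  set β := -g' (0, 1) (0, 1) with hβ
  have hβ0 : 0 < β := by
    by_contra! h
    nlinarith
  -- Only the time component of `v` is changed: this restores nullity for `g'` and, since `ℓ (0, 1)
  -- = 0`, keeps the vector in `ker ℓ`.
  obtain ⟨σ, hσ0, hσ⟩ := exists_root_near (τ := v.2) (W := g' (v.1, 0) (0, 1)) hβ0 (hpos v.1)
  rw [← quadratic_expansion g' hsymm] at hσ0
  rw [← quadratic_expansion g' hsymm, Prod.mk.eta, hv2, ← ht] at hσ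
  set D := |σ - w.2| with hD
  have hD0 : 0 ≤ D := abs_nonneg _
  have hDle : D ≤ 4 * K ^ 6 * (A * t + B) := by
    have h1 : t * D ≤ t * (4 * K ^ 6 * (A * t + B)) := by
      calc t * D ≤ (K * β) * (t * D) := le_mul_of_one_le_left (by positivity) hneg
        _ = K * (β * t * D) := by ring
        _ ≤ K * (4 * K ^ 5 * (A * t ^ 2 + B * t)) :=
          mul_le_mul_of_nonneg_left (hσ.trans hQ) hK0.le
        _ = _ := by ring
    exact le_of_mul_le_mul_left h1 ht0
  have hDt : D ≤ 8 * K ^ 8 * t := by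
    calc D ≤ 4 * K ^ 6 * (1 * t + K ^ 2 * t) := hDle.trans (by gcongr)
      _ ≤ 4 * K ^ 6 * (K ^ 2 * t + K ^ 2 * t) := by
        have := pow_le 0 2 (by norm_num)
        gcongr; simpa using this
      _ = _ := by ring
  set v' : E × ℝ := (v.1, σ) with hv'
  have hvv' : v - v' = (w.2 - σ) • ((0 : E), (1 : ℝ)) := by
    ext
    · simp [hv']
    · simp [hv', hv2]
  have hvv'n : ‖v - v'‖ = D := by
    rw [hvv', norm_smul, Real.norm_eq_abs, abs_sub_comm, Prod.norm_mk]
    simp [hD]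
  have hv'n : ‖v'‖ ≤ 10 * K ^ 8 * t := by
    calc ‖v'‖ = ‖v - (v - v')‖ := by rw [sub_sub_cancel]
      _ ≤ 2 * K ^ 3 * t + 8 * K ^ 8 * t :=
        (norm_sub_le _ _).trans (add_le_add hvn (hvv'n.trans_le hDt))
      _ ≤ 2 * K ^ 8 * t + 8 * K ^ 8 * t := by
        have := pow_le 3 8 (by norm_num)
        gcongr
      _ = _ := by ring
  have hℓv' : ℓ v' = 0 := by
    have : ℓ (v - v') = 0 := by rw [hvv', map_smul, hℓT, smul_zero]
    rw [map_sub, hℓw, zero_sub, neg_eq_zero] at this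
    exact this
  have hHv' : S v' v' - ℓ (Γ' v' v') ≤ 0 := by
    rcases eq_or_ne v' 0 with h | h
    · simp [h]
    · exact hess v' h hσ0 hℓv'
  have hvv'sum : ‖v‖ + ‖v'‖ ≤ 12 * K ^ 8 * t := by
    have := pow_le 3 8 (by norm_num)
    calc ‖v‖ + ‖v'‖ ≤ 2 * K ^ 3 * t + 10 * K ^ 8 * t := add_le_add hvn hv'n
      _ ≤ 2 * K ^ 8 * t + 10 * K ^ 8 * t := by gcongr
      _ = _ := by ring
  -- `d1` and `d2` pay for passing from `v'` to `v`; `d3` pays for replacing `Γ', v` by `Γ, w`.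
  have d1 : S v v - S v' v' ≤ 48 * K ^ 15 * (A * t ^ 2 + B * t) := by
    have h1 := norm_bilin_sub_le S S v v'
    rw [sub_self, norm_zero, zero_mul, zero_add, hvv'n] at h1
    calc S v v - S v' v' ≤ ‖S‖ * (‖v‖ + ‖v'‖) * D := (Real.le_norm_self _).trans h1
      _ ≤ K * (12 * K ^ 8 * t) * (4 * K ^ 6 * (A * t + B)) := by gcongr
      _ = _ := by ring
  have d2 : ℓ (Γ' v' v') - ℓ (Γ' v v) ≤ 48 * K ^ 16 * (A * t ^ 2 + B * t) := by
    have h1 := norm_bilin_sub_le Γ' Γ' v v'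
    rw [sub_self, norm_zero, zero_mul, zero_add, hvv'n] at h1
    rw [← map_sub]
    calc ℓ (Γ' v' v' - Γ' v v) ≤ ‖ℓ‖ * ‖Γ' v' v' - Γ' v v‖ :=
          (Real.le_norm_self _).trans (ℓ.le_opNorm _)
      _ ≤ K * (K * (12 * K ^ 8 * t) * (4 * K ^ 6 * (A * t + B))) := by
        rw [norm_sub_rev]
        gcongr
        exact h1.trans (by gcongr)
      _ = _ := by ring
  have d3 : ℓ (Γ' v v) - ℓ (Γ w w) ≤ 4 * K ^ 6 * (A * t ^ 2 + B * t) := by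
    have h1 := norm_bilin_sub_le Γ Γ' v w
    rw [← map_sub]
    calc ℓ (Γ' v v - Γ w w) ≤ ‖ℓ‖ * ‖Γ' v v - Γ w w‖ :=
          (Real.le_norm_self _).trans (ℓ.le_opNorm _)
      _ ≤ K * (K * A * (K * t) ^ 2 + K * (2 * K ^ 3 * t + K ^ 3 * t) * (K * B)) := by
        gcongr
        exact h1.trans (by gcongr)
      _ = K ^ 4 * (A * t ^ 2) + 3 * K ^ 6 * (B * t) := by ring
      _ ≤ (4 * K ^ 6) * (A * t ^ 2) + (4 * K ^ 6) * (B * t) := by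
        have := pow_le 4 6 (by norm_num)
        have := pow_pos hK0 6
        gcongr <;> linarith
      _ = _ := by ring
  rw [htt]
  -- All powers of `K` are raised to the sixteenth; the constant is `48 + 48 + 4 = 100`.
  have p1 : K ^ 15 * (A * t ^ 2 + B * t) ≤ K ^ 16 * (A * t ^ 2 + B * t) := by
    have := pow_le 15 16 (by norm_num)
    gcongr
  have p2 : K ^ 6 * (A * t ^ 2 + B * t) ≤ K ^ 16 * (A * t ^ 2 + B * t) := by
    have := pow_le 6 16 (by norm_num)
    gcongr
  linarith

end PointEstimate

/-! ### Projection onto a level set along a transversal -/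

section Projection

variable {X : Type*} [NormedAddCommGroup X] [NormedSpace ℝ X] [CompleteSpace X]

/-- The projection onto the zero set of `f` along a transversal direction `N`. -/
theorem exists_projection_along {f : X → ℝ} {z₀ N : X} (hf : ContDiffAt ℝ 2 f z₀)
    (hN : fderiv ℝ f z₀ N ≠ 0) :
    ∃ h : X → ℝ, ContDiffAt ℝ 2 h z₀ ∧ h z₀ = 0 ∧ ∀ᶠ z in 𝓝 z₀, f (z + h z • N) = f z₀ := by
  let A : X × ℝ →L[ℝ] X := ContinuousLinearMap.fst ℝ X ℝ +
    (ContinuousLinearMap.snd ℝ X ℝ).smulRight N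
  have hA : ∀ p : X × ℝ, A p = p.1 + p.2 • N := fun p => rfl
  have hA0 : A (z₀, 0) = z₀ := by simp [hA]
  have hfA : ContDiffAt ℝ 2 (fun p => f (A p)) (z₀, (0 : ℝ)) :=
    ContDiffAt.comp (z₀, (0 : ℝ)) (by rwa [hA0]) A.contDiff.contDiffAt
  have hd : fderiv ℝ (fun p => f (A p)) (z₀, (0 : ℝ)) = (fderiv ℝ f z₀).comp A := by
    have h1 : HasFDerivAt f (fderiv ℝ f z₀) (A (z₀, 0)) := by
      rw [hA0]; exact (hf.differentiableAt (by norm_num)).hasFDerivAt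
    exact (h1.comp (z₀, (0 : ℝ)) A.hasFDerivAt).fderiv
  -- The implicit function theorem is applied to `(z, t) ↦ f (z + t N)`, whose `t`-derivative at
  -- `(z₀, 0)` is `df N ≠ 0`.
  have hinv : (fderiv ℝ (fun p => f (A p)) (z₀, (0 : ℝ)) ∘L .inr ℝ X ℝ).IsInvertible := by
    refine ⟨ContinuousLinearEquiv.unitsEquivAut ℝ (Units.mk0 _ hN), ?_⟩
    rw [hd]
    ext
    simp [hA]
  have h2 : (2 : WithTop ℕ∞) ≠ 0 := by norm_num
  refine ⟨hfA.implicitFunction h2 hinv, hfA.contDiffAt_implicitFunction h2 hinv,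
    hfA.implicitFunction_apply_self h2 hinv, ?_⟩
  filter_upwards [hfA.eventually_apply_implicitFunction h2 hinv] with z hz
  simpa [hA] using hz

end Projection

/-! ### Lightlike vectors are dominated by their time component -/

section LocalBounds

theorem exists_eventually_norm_le {X Y : Type*} [NormedAddCommGroup X]
    [NormedAddCommGroup Y] {F : X → Y} {z₀ : X} (h : ContinuousAt F z₀) :
    ∃ K : ℝ, ∀ᶠ z in 𝓝 z₀, ‖F z‖ ≤ K :=
  ⟨‖F z₀‖ + 1, (h.norm.eventually_lt_const (lt_add_one _)).mono fun _ h => le_of_lt h⟩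

variable {E : Type*} [NormedAddCommGroup E] [NormedSpace ℝ E] [FiniteDimensional ℝ E]

/-- Compactness of the unit sphere bounds the spatial part of `G z₀` below by `m ‖y‖²`, and half of
this survives nearby. For a null vector the mixed and time terms must cancel it, so `‖y‖` is at most
a multiple of `|σ|`. Consequently a lightlike velocity never has zero time component. -/
theorem exists_lightlike_norm_le {G : E × ℝ → E × ℝ →L[ℝ] E × ℝ →L[ℝ] ℝ} {z₀ : E × ℝ}
    (hG : ContinuousAt G z₀) (hpos : ∀ y : E, y ≠ 0 → 0 < G z₀ (y, 0) (y, 0)) :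
    ∃ K : ℝ, ∀ᶠ z in 𝓝 z₀, (∀ y : E, 0 ≤ G z (y, 0) (y, 0)) ∧
      ∀ v, G z v v = 0 → ‖v‖ ≤ K * |v.2| := by
  have hcont : Continuous fun y : E => G z₀ (y, 0) (y, 0) := by fun_prop
  obtain ⟨m, hm, hmle⟩ := (isCompact_sphere (0 : E) 1).exists_forall_le' hcont.continuousOn
    (a := 0) fun y hy => hpos y (by rintro rfl; simp at hy)
  have hn : ∀ y : E, ‖((y, 0) : E × ℝ)‖ = ‖y‖ := fun y => by simp [Prod.norm_mk]
  have hm' : ∀ y : E, m * ‖y‖ ^ 2 ≤ G z₀ (y, 0) (y, 0) := by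
    intro y
    rcases eq_or_ne y 0 with rfl | hy
    · rw [show ((0 : E), (0 : ℝ)) = 0 from rfl]; simp
    have hy0 : ‖y‖ ≠ 0 := norm_ne_zero_iff.2 hy
    have h1 := hmle (‖y‖⁻¹ • y) (by simp [norm_smul, hy0])
    have e : ((‖y‖⁻¹ • y, 0) : E × ℝ) = ‖y‖⁻¹ • (y, 0) := by simp
    rw [e, map_smul, map_smul, smul_apply, smul_eq_mul, smul_eq_mul] at h1
    have := mul_le_mul_of_nonneg_right h1 (sq_nonneg ‖y‖)
    field_simp at this
    linarith
  obtain ⟨M, hM⟩ := exists_eventually_norm_le hG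
  have hclose : ∀ᶠ z in 𝓝 z₀, ‖G z - G z₀‖ < m / 2 := by
    have h1 : ContinuousAt (fun z => ‖G z - G z₀‖) z₀ := (hG.sub continuousAt_const).norm
    exact h1.eventually_lt_const (by simpa using hm)
  have hM0 : 0 ≤ M := (norm_nonneg _).trans hM.self_of_nhds
  -- Once `|σ| ≤ ‖y‖`, nullity gives `m ‖y‖ ≤ 4 M |σ|`, so `6 M / m` leaves room; the `+ 1` covers
  -- the component `σ` itself and justifies `|σ| ≤ ‖y‖` in the argument by contradiction.
  refine ⟨6 * M / m + 1, ?_⟩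
  filter_upwards [hM, hclose] with z hzM hz
  have hlow : ∀ y : E, m / 2 * ‖y‖ ^ 2 ≤ G z (y, 0) (y, 0) := by
    intro y
    have h1 := (G z - G z₀).le_opNorm₂ (y, 0) (y, 0)
    rw [hn, sub_apply, sub_apply, Real.norm_eq_abs] at h1
    have h2 : ‖G z - G z₀‖ * ‖y‖ * ‖y‖ ≤ m / 2 * ‖y‖ ^ 2 := by
      rw [mul_assoc, ← sq]; gcongr
    linarith [hm' y, neg_abs_le (G z (y, 0) (y, 0) - G z₀ (y, 0) (y, 0))]
  refine ⟨fun y => (by positivity : (0 : ℝ) ≤ m / 2 * ‖y‖ ^ 2).trans (hlow y), ?_⟩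
  rintro ⟨y, σ⟩ hv
  have hk1 : 1 ≤ 6 * M / m + 1 := by
    have : 0 ≤ 6 * M / m := by positivity
    linarith
  rw [Prod.norm_mk]
  refine max_le ?_ (by simpa using le_mul_of_one_le_left (abs_nonneg σ) hk1)
  by_contra! hcon
  simp only at hcon
  have hy0 : 0 < ‖y‖ := lt_of_le_of_lt (by positivity) hcon
  have hσy : |σ| ≤ ‖y‖ := (le_mul_of_one_le_left (abs_nonneg σ) hk1).trans hcon.le
  have e : ((y, σ) : E × ℝ) = (y, 0) + (0, σ) := by simp
  have hs : ‖((0, σ) : E × ℝ)‖ = |σ| := by simp [Prod.norm_mk]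
  have b1 := (G z).le_opNorm₂ (y, 0) (0, σ)
  have b2 := (G z).le_opNorm₂ (0, σ) (y, σ)
  have hys : ‖((y, σ) : E × ℝ)‖ = ‖y‖ := by
    rw [Prod.norm_mk, Real.norm_eq_abs]; exact max_eq_left hσy
  rw [hn, hs, Real.norm_eq_abs] at b1
  rw [hs, hys, Real.norm_eq_abs] at b2
  have hexp : G z (y, σ) (y, σ) = G z (y, 0) (y, 0) + G z (y, 0) (0, σ) + G z (0, σ) (y, σ) := by
    have gen : ∀ a b : E × ℝ, G z (a + b) (a + b) = G z a a + G z a b + G z b (a + b) := by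
      intro a b
      conv_lhs => rw [map_add (G z), add_apply, map_add (G z a)]
    have := gen (y, 0) (0, σ)
    rwa [← e] at this
  rw [hv] at hexp
  have b3 : ‖G z‖ * ‖y‖ * |σ| ≤ M * ‖y‖ * |σ| := by gcongr
  have b5 : ‖G z‖ * |σ| * ‖y‖ ≤ M * |σ| * ‖y‖ := by gcongr
  have b4 : m / 2 * ‖y‖ ^ 2 ≤ 2 * M * ‖y‖ * |σ| := by
    linarith [hlow y, neg_abs_le (G z (y, 0) (0, σ)), neg_abs_le (G z (0, σ) (y, σ))]
  have b6 : m * ‖y‖ ≤ 4 * M * |σ| := by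
    have : ‖y‖ * (m * ‖y‖) ≤ ‖y‖ * (4 * M * |σ|) := by linarith
    exact le_of_mul_le_mul_left this hy0
  have b7 : m * ((6 * M / m + 1) * |σ|) < m * ‖y‖ := by gcongr
  have b8 : m * ((6 * M / m + 1) * |σ|) = 6 * M * |σ| + m * |σ| := by field_simp
  nlinarith [abs_nonneg σ, mul_nonneg hM0 (abs_nonneg σ), mul_nonneg hm.le (abs_nonneg σ)]

end LocalBounds

/-! ### From the infinitesimal to the local condition, in coordinates -/

section Coordinates

variable {E : Type*} [NormedAddCommGroup E] [NormedSpace ℝ E] [FiniteDimensional ℝ E]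

/-- Bounds for a metric `G` and a defining function `f` that are valid near a point. -/
structure LocalBounds (G : E × ℝ → E × ℝ →L[ℝ] E × ℝ →L[ℝ] ℝ) (f : E × ℝ → ℝ) (N : E × ℝ) (K : ℝ)
    (z : E × ℝ) : Prop where
  norm_metric : ‖G z‖ ≤ K
  norm_christoffel : ‖christoffelBilin G z‖ ≤ K
  norm_fderiv : ‖fderiv ℝ f z‖ ≤ K
  norm_fderiv_fderiv : ‖fderiv ℝ (fderiv ℝ f) z‖ ≤ K
  transversal : 1 / 2 ≤ fderiv ℝ f z N
  timelike : 1 ≤ K * -G z (0, 1) (0, 1)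
  spacelike : ∀ y : E, 0 ≤ G z (y, 0) (y, 0)
  lightlike : ∀ v, G z v v = 0 → ‖v‖ ≤ K * |v.2|
  symm : ∀ u v, G z u v = G z v u
  contDiffAt : ContDiffAt ℝ 2 f z
  tangent : f z = 0 → fderiv ℝ f z (0, 1) = 0
  hessian : f z = 0 → ∀ v, v ≠ 0 → G z v v = 0 → fderiv ℝ f z v = 0 →
    fderiv ℝ (fderiv ℝ f) z v v - fderiv ℝ f z (christoffel G z v v) ≤ 0

/-- Each bound holds near `z₀` by continuity, and each remains true when `K` grows. This freedom
lets one constant absorb the further Lipschitz bounds later on. -/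
theorem exists_localBounds {G : E × ℝ → E × ℝ →L[ℝ] E × ℝ →L[ℝ] ℝ} {f : E × ℝ → ℝ}
    {z₀ N : E × ℝ} (hG : ContDiffAt ℝ 2 G z₀) (inv : (G z₀).IsInvertible)
    (hsymm : ∀ᶠ z in 𝓝 z₀, ∀ u v, G z u v = G z v u)
    (hpos : ∀ y : E, y ≠ 0 → 0 < G z₀ (y, 0) (y, 0)) (hneg : G z₀ (0, 1) (0, 1) < 0)
    (hf : ContDiffAt ℝ 2 f z₀) (hN : fderiv ℝ f z₀ N = 1)
    (htan : ∀ᶠ z in 𝓝 z₀, f z = 0 → fderiv ℝ f z (0, 1) = 0)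
    (hess : ∀ᶠ z in 𝓝 z₀, f z = 0 → ∀ v, v ≠ 0 → G z v v = 0 → fderiv ℝ f z v = 0 →
      fderiv ℝ (fderiv ℝ f) z v v - fderiv ℝ f z (christoffel G z v v) ≤ 0) :
    ∃ K₀ : ℝ, ∀ K, K₀ ≤ K → ∀ᶠ z in 𝓝 z₀, LocalBounds G f N K z := by
  have hB := contDiffAt_christoffelBilin hG inv
  have hf1 : ContDiffAt ℝ 1 (fderiv ℝ f) z₀ := hf.fderiv_right (by norm_num)
  have hf2 : ContDiffAt ℝ 0 (fderiv ℝ (fderiv ℝ f)) z₀ := hf1.fderiv_right (by norm_num)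
  obtain ⟨K₁, h₁⟩ := exists_eventually_norm_le hG.continuousAt
  obtain ⟨K₂, h₂⟩ := exists_eventually_norm_le hB.continuousAt
  obtain ⟨K₃, h₃⟩ := exists_eventually_norm_le hf1.continuousAt
  obtain ⟨K₄, h₄⟩ := exists_eventually_norm_le hf2.continuousAt
  obtain ⟨K₅, h₅⟩ := exists_lightlike_norm_le hG.continuousAt hpos
  have h₆ : ∀ᶠ z in 𝓝 z₀, 1 / 2 < fderiv ℝ f z N := by
    have : ContinuousAt (fun z => fderiv ℝ f z N) z₀ :=
      hf1.continuousAt.clm_apply continuousAt_const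
    exact this.eventually_const_lt (by change 1 / 2 < fderiv ℝ f z₀ N; rw [hN]; norm_num)
  set β := -G z₀ (0, 1) (0, 1) with hβ
  have hβ0 : 0 < β := by linarith
  have h₇ : ∀ᶠ z in 𝓝 z₀, β / 2 < -G z (0, 1) (0, 1) := by
    have : ContinuousAt (fun z => -G z (0, 1) (0, 1)) z₀ :=
      ((hG.continuousAt.clm_apply continuousAt_const).clm_apply continuousAt_const).neg
    exact this.eventually_const_lt (by linarith)
  refine ⟨max (max (max K₁ K₂) (max K₃ K₄)) (max K₅ (2 / β)), fun K hK => ?_⟩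
  simp only [max_le_iff] at hK
  obtain ⟨⟨⟨k₁, k₂⟩, k₃, k₄⟩, k₅, k₆⟩ := hK
  filter_upwards [h₁, h₂, h₃, h₄, h₅, h₆, h₇, hsymm, htan, hess, hf.eventually (by norm_num)] with z
    a₁ a₂ a₃ a₄ a₅ a₆ a₇ a₈ a₉ a₁₀ a₁₁
  exact {
    norm_metric := a₁.trans k₁
    norm_christoffel := a₂.trans k₂
    norm_fderiv := a₃.trans k₃
    norm_fderiv_fderiv := a₄.trans k₄
    transversal := a₆.le
    timelike := by
      calc (1 : ℝ) = 2 / β * (β / 2) := by field_simp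
        _ ≤ K * -G z (0, 1) (0, 1) := by
          apply mul_le_mul k₆ a₇.le (by positivity)
          exact (by positivity : (0 : ℝ) ≤ 2 / β).trans k₆
    spacelike := a₅.1
    lightlike := fun v hv => (a₅.2 v hv).trans (by gcongr)
    symm := a₈
    contDiffAt := a₁₁
    tangent := a₉
    hessian := a₁₀ }

/-- In coordinates: if the Hessian of `f` is non-positive on lightlike vectors tangent to
`{f = 0}`, a timelike symmetry direction being tangent to that hypersurface, then the lightlike
geodesics near `z₀` that are tangent to `{f = 0}` at `z₀` stay in `{f ≤ 0}`. -/
theorem exists_ball_lightlike_geodesic_nonpos {G : E × ℝ → E × ℝ →L[ℝ] E × ℝ →L[ℝ] ℝ}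
    {f : E × ℝ → ℝ} {z₀ : E × ℝ} (hG : ContDiffAt ℝ 2 G z₀) (inv : (G z₀).IsInvertible)
    (hsymm : ∀ᶠ z in 𝓝 z₀, ∀ u v, G z u v = G z v u)
    (hpos : ∀ y : E, y ≠ 0 → 0 < G z₀ (y, 0) (y, 0)) (hneg : G z₀ (0, 1) (0, 1) < 0)
    (hf : ContDiffAt ℝ 2 f z₀) (hf0 : f z₀ = 0) (hdf : fderiv ℝ f z₀ ≠ 0)
    (htan : ∀ᶠ z in 𝓝 z₀, f z = 0 → fderiv ℝ f z (0, 1) = 0)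
    (hess : ∀ᶠ z in 𝓝 z₀, f z = 0 → ∀ v, v ≠ 0 → G z v v = 0 → fderiv ℝ f z v = 0 →
      fderiv ℝ (fderiv ℝ f) z v v - fderiv ℝ f z (christoffel G z v v) ≤ 0) :
    ∃ ε > 0, ∀ (a b : ℝ) (c c₁ : ℝ → E × ℝ), a < 0 → 0 < b → c 0 = z₀ →
      (∀ s ∈ Ioo a b, HasDerivAt c (c₁ s) s ∧
        HasDerivAt c₁ (-christoffel G (c s) (c₁ s) (c₁ s)) s ∧ c s ∈ Metric.ball z₀ ε ∧
        c₁ s ≠ 0 ∧ G (c s) (c₁ s) (c₁ s) = 0) →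
      fderiv ℝ f z₀ (c₁ 0) = 0 → ∀ s ∈ Ioo a b, f (c s) ≤ 0 := by
  -- `df` kills the time direction, so it is non-zero on some spatial vector. A spatial `N` leaves
  -- the time component of the velocity unchanged by the projection.
  obtain ⟨N, hN2, hN⟩ : ∃ N : E × ℝ, N.2 = 0 ∧ fderiv ℝ f z₀ N = 1 := by
    obtain ⟨n, hn⟩ : ∃ n : E, fderiv ℝ f z₀ (n, 0) ≠ 0 := by
      by_contra! h
      apply hdf
      ext v
      · simpa using h v
      · simpa using htan.self_of_nhds hf0
    exact ⟨(fderiv ℝ f z₀ (n, 0))⁻¹ • (n, 0), by simp, by rw [map_smul, smul_eq_mul, inv_mul_cancel₀ hn]⟩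
  obtain ⟨h, hh, hh0, hfh⟩ := exists_projection_along (N := N) hf (by rw [hN]; norm_num)
  obtain ⟨K₀, hK₀⟩ := exists_localBounds hG inv hsymm hpos hneg hf hN htan hess
  obtain ⟨L₁, s₁, hs₁, hL₁⟩ := (hG.of_le (by norm_num : (1 : WithTop ℕ∞) ≤ 2)).exists_lipschitzOnWith
  obtain ⟨L₂, s₂, hs₂, hL₂⟩ := (contDiffAt_christoffelBilin hG inv).exists_lipschitzOnWith
  have hh1 : ContDiffAt ℝ 1 (fderiv ℝ h) z₀ := hh.fderiv_right (by norm_num)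
  obtain ⟨K₁, hK₁⟩ := exists_eventually_norm_le hh1.continuousAt
  obtain ⟨K, hK⟩ : ∃ K, max (max (max K₀ 1) (max K₁ ‖N‖)) (max (L₁ * ‖N‖) (L₂ * ‖N‖)) = K :=
    ⟨_, rfl⟩
  have hK := hK.le
  simp only [max_le_iff] at hK
  obtain ⟨⟨⟨k₀, k1⟩, k₁, kN⟩, kL₁, kL₂⟩ := hK
  obtain ⟨r, hr, hgood⟩ := Metric.eventually_nhds_iff_ball.1
    ((hK₀ K k₀).and ((Filter.eventually_mem_set.2 hs₁).and (Filter.eventually_mem_set.2 hs₂)))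
  have hRc : ContinuousAt (fun z => z + h z • N) z₀ :=
    continuousAt_id.add (hh.continuousAt.smul continuousAt_const)
  have hR0 : z₀ + h z₀ • N = z₀ := by simp [hh0]
  have hRr : ∀ᶠ z in 𝓝 z₀, z + h z • N ∈ Metric.ball z₀ r := by
    apply hRc
    change Metric.ball z₀ r ∈ 𝓝 (z₀ + h z₀ • N)
    rw [hR0]
    exact Metric.ball_mem_nhds _ hr
  have hh_small : ∀ᶠ z in 𝓝 z₀, |h z| < 1 :=
    hh.continuousAt.abs.eventually_lt_const (by simp [hh0])
  obtain ⟨r', hr', hgood'⟩ := Metric.eventually_nhds_iff_ball.1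
    (hRr.and (hh_small.and (hfh.and (hK₁.and (hh.eventually (by norm_num))))))
  -- Twice the constant of `hessian_almost_nonpos`, because dividing by `df N ≥ 1/2` costs a factor
  -- two.
  set C : ℝ := 200 * K ^ 16 with hC
  have hC0 : 0 < C := by positivity
  -- The radii `r` and `r'` keep `c` and its projection where the bounds hold; the other two entries
  -- give `C (ε + 2) ε ≤ 3 C ε < 1`.
  set ε : ℝ := min (min r r') (min 1 (1 / (3 * C + 1))) with hε
  have hε0 : 0 < ε := by positivity
  have hε1 : ε ≤ 1 := (min_le_right _ _).trans (min_le_left _ _)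
  have hεC : C * (ε + 2) * ε < 1 := by
    have e1 : ε ≤ 1 / (3 * C + 1) := (min_le_right _ _).trans (min_le_right _ _)
    rw [le_div_iff₀ (by positivity)] at e1
    nlinarith [mul_pos hC0 hε0]
  refine ⟨ε, hε0, fun a b c c₁ ha hb hc0 hc htan0 => ?_⟩
  have h0 : (0 : ℝ) ∈ Ioo a b := ⟨ha, hb⟩
  have hcr : ∀ s ∈ Ioo a b, c s ∈ Metric.ball z₀ r := fun s hs =>
    Metric.ball_subset_ball ((min_le_left _ _).trans (min_le_left _ _)) (hc s hs).2.2.1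
  have hcr' : ∀ s ∈ Ioo a b, c s ∈ Metric.ball z₀ r' := fun s hs =>
    Metric.ball_subset_ball ((min_le_left _ _).trans (min_le_right _ _)) (hc s hs).2.2.1
  set ρ : ℝ → ℝ := fun s => h (c s) with hρ
  set ρ₁ : ℝ → ℝ := fun s => fderiv ℝ h (c s) (c₁ s) with hρ₁
  set c₂ : ℝ → E × ℝ := fun s => -christoffel G (c s) (c₁ s) (c₁ s) with hc₂
  set ρ₂ : ℝ → ℝ := fun s => fderiv ℝ (fderiv ℝ h) (c s) (c₁ s) (c₁ s) + fderiv ℝ h (c s) (c₂ s)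
    with hρ₂
  have dρ : ∀ s ∈ Ioo a b, HasDerivAt ρ (ρ₁ s) s := fun s hs =>
    hasDerivAt_comp_curve ((hgood' _ (hcr' s hs)).2.2.2.2.differentiableAt (by norm_num)) (hc s hs).1
  have dρ₁ : ∀ s ∈ Ioo a b, HasDerivAt ρ₁ (ρ₂ s) s := fun s hs =>
    hasDerivAt_fderiv_apply (hgood' _ (hcr' s hs)).2.2.2.2 (hc s hs).1 (hc s hs).2.1
  set p : ℝ → E × ℝ := fun s => c s + ρ s • N with hp
  set p₁ : ℝ → E × ℝ := fun s => c₁ s + ρ₁ s • N with hp₁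
  have dp : ∀ s ∈ Ioo a b, HasDerivAt p (p₁ s) s := fun s hs =>
    (hc s hs).1.add ((dρ s hs).smul_const N)
  have dp₁ : ∀ s ∈ Ioo a b, HasDerivAt p₁ (c₂ s + ρ₂ s • N) s := fun s hs =>
    (hc s hs).2.1.add ((dρ₁ s hs).smul_const N)
  have hpr : ∀ s ∈ Ioo a b, p s ∈ Metric.ball z₀ r := fun s hs => (hgood' _ (hcr' s hs)).1
  have hp0 : ∀ s ∈ Ioo a b, f (p s) = 0 := fun s hs =>
    (hgood' _ (hcr' s hs)).2.2.1.trans hf0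
  have zero_of_deriv : ∀ (F : ℝ → ℝ) (F' s : ℝ), s ∈ Ioo a b → (∀ s ∈ Ioo a b, F s = 0) →
      HasDerivAt F F' s → F' = 0 := fun F F' s hs hF hd =>
    hd.unique ((hasDerivAt_const s (0 : ℝ)).congr_of_eventuallyEq
      (Filter.eventuallyEq_of_mem (isOpen_Ioo.mem_nhds hs) hF))
  have hp₁0 : ∀ s ∈ Ioo a b, fderiv ℝ f (p s) (p₁ s) = 0 := fun s hs =>
    zero_of_deriv _ _ s hs hp0 (hasDerivAt_comp_curve
      ((hgood _ (hpr s hs)).1.contDiffAt.differentiableAt (by norm_num)) (dp s hs))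
  -- The second derivative of `f ∘ p = 0`. As `c₂` is minus the Christoffel term, it reads `-ρ₂
  -- df(N) = D²f(p₁, p₁) - df(Γ(c₁, c₁))`, with `Γ` taken at `c s` and `f` differentiated at `p s`.
  have hp₂0 : ∀ s ∈ Ioo a b, fderiv ℝ (fderiv ℝ f) (p s) (p₁ s) (p₁ s) +
      fderiv ℝ f (p s) (c₂ s + ρ₂ s • N) = 0 := fun s hs =>
    zero_of_deriv _ _ s hs hp₁0
      (hasDerivAt_fderiv_apply (hgood _ (hpr s hs)).1.contDiffAt (dp s hs) (dp₁ s hs))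
  have hlight : ∀ s ∈ Ioo a b, ‖c₁ s‖ ≤ K * |(c₁ s).2| := fun s hs =>
    (hgood _ (hcr s hs)).1.lightlike _ (hc s hs).2.2.2.2
  have hτ0 : ∀ s ∈ Ioo a b, (c₁ s).2 ≠ 0 := by
    intro s hs h2
    have := hlight s hs
    rw [h2, abs_zero, mul_zero] at this
    exact (hc s hs).2.2.2.1 (norm_le_zero_iff.1 this)
  have hpc : ∀ s, ‖p s - c s‖ = |ρ s| * ‖N‖ := fun s => by
    rw [hp]; simp [norm_smul]
  -- The maximum principle for `-ρ`, with the time coordinate as comparison parameter.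
  have main : ∀ s ∈ Ioo a b, -ρ s ≤ 0 := by
    refine nonpos_of_second_order_ineq_Ioo (u₁ := fun s => -ρ₁ s) (u₂ := fun s => -ρ₂ s)
      (t := fun s => (c s).2) (τ := fun s => (c₁ s).2) (τ₁ := fun s => (c₂ s).2) ha hb hC0.le hεC
      (fun s hs => (dρ s hs).neg) (fun s hs => (dρ₁ s hs).neg) (fun s hs => (hc s hs).1.snd)
      (fun s hs => (hc s hs).2.1.snd) hτ0 ?_ ?_ ?_ ?_ ?_
    · intro s hs
      have e1 : |(c₂ s).2| ≤ ‖christoffelBilin G (c s) (c₁ s) (c₁ s)‖ := by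
        rw [christoffelBilin_apply, ← norm_neg]
        exact norm_snd_le (c₂ s)
      refine e1.trans (((christoffelBilin G (c s)).le_opNorm₂ _ _).trans ?_)
      calc ‖christoffelBilin G (c s)‖ * ‖c₁ s‖ * ‖c₁ s‖
          ≤ K * (K * |(c₁ s).2|) * (K * |(c₁ s).2|) := by
            gcongr
            exacts [(hgood _ (hcr s hs)).1.norm_christoffel, hlight s hs, hlight s hs]
        _ = K ^ 3 * (c₁ s).2 ^ 2 := by rw [← sq_abs (c₁ s).2]; ring
        _ ≤ C * (c₁ s).2 ^ 2 := by
          have : K ^ 3 ≤ K ^ 16 := pow_le_pow_right₀ k1 (by norm_num)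
          have : 0 ≤ K ^ 16 := by positivity
          gcongr
          linarith
    · intro s hs
      have gp := hgood _ (hpr s hs)
      have gc := hgood _ (hcr s hs)
      have est := hessian_almost_nonpos (K := K) (ρ := ρ s) (ρ₁ := ρ₁ s) k1 (g := G (c s))
        (g' := G (p s)) (S := fderiv ℝ (fderiv ℝ f) (p s)) (Γ := christoffelBilin G (c s))
        (Γ' := christoffelBilin G (p s)) (ℓ := fderiv ℝ f (p s)) (N := N) (w := c₁ s)
        gp.1.norm_metric
        ((hL₁.norm_sub_le gp.2.1 gc.2.1).trans (by
          rw [hpc, mul_comm |ρ s|, ← mul_assoc]; gcongr))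
        gp.1.norm_christoffel
        ((hL₂.norm_sub_le gp.2.2 gc.2.2).trans (by
          rw [hpc, mul_comm |ρ s|, ← mul_assoc]; gcongr))
        gp.1.norm_fderiv gp.1.norm_fderiv_fderiv kN (hgood' _ (hcr' s hs)).2.1.le
        (((fderiv ℝ h (c s)).le_opNorm (c₁ s)).trans (by
          gcongr; exact (hgood' _ (hcr' s hs)).2.2.2.1.trans k₁))
        (hlight s hs) (hτ0 s hs) hN2 gp.1.symm gp.1.spacelike gp.1.timelike (hc s hs).2.2.2.2
        (hp₁0 s hs) (gp.1.tangent (hp0 s hs)) (fun v hv hgv hlv => by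
          rw [christoffelBilin_apply]
          exact gp.1.hessian (hp0 s hs) v hv hgv hlv)
      have e2 := hp₂0 s hs
      rw [(fderiv ℝ f (p s)).map_add, (fderiv ℝ f (p s)).map_smul, smul_eq_mul,
        (fderiv ℝ f (p s)).map_neg] at e2
      rw [christoffelBilin_apply] at est
      rw [abs_neg, abs_neg]
      set Q := |ρ s| * (c₁ s).2 ^ 2 + |ρ₁ s| * |(c₁ s).2| with hQ
      have hQ0 : 0 ≤ Q := by positivity
      have e3 : -ρ₂ s * fderiv ℝ f (p s) N ≤ 100 * K ^ 16 * Q := by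
        refine le_trans (le_of_eq ?_) est
        simp only [hp₁] at e2
        linarith
      have htr := gp.1.transversal
      by_contra! hcon
      have : 0 ≤ C * Q := by positivity
      nlinarith
    · intro s hs
      have : ‖(c s - z₀).2‖ ≤ ‖c s - z₀‖ := norm_snd_le _
      rw [hc0]
      exact this.trans (mem_ball_iff_norm.1 (hc s hs).2.2.1).le
    · simp [hρ, hc0, hh0]
    · have e1 := hp₁0 0 h0
      have e2 : p 0 = z₀ := by simp [hp, hρ, hc0, hh0]
      rw [e2, hp₁, map_add, htan0, zero_add, map_smul, hN, smul_eq_mul, mul_one] at e1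
      simp [e1]
  intro s hs
  have hρs : 0 ≤ ρ s := by linarith [main s hs]
  -- The segment from `c s` to `p s` lies in the convex ball, where `f` increases along `N`; hence
  -- `f (c s) ≤ f (p s) = 0`.
  have hseg : ∀ t ∈ Icc 0 (ρ s), c s + t • N ∈ Metric.ball z₀ r := by
    intro t ht
    rcases hρs.eq_or_lt with h0 | h0
    · have : t = 0 := le_antisymm (h0 ▸ ht.2) ht.1
      rw [this, zero_smul, add_zero]; exact hcr s hs
    · have := (convex_ball z₀ r).add_smul_sub_mem (hcr s hs) (hpr s hs) (t := t / ρ s)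
        ⟨div_nonneg ht.1 hρs, div_le_one_of_le₀ ht.2 hρs⟩
      simpa [hp, smul_smul, div_mul_cancel₀ _ h0.ne'] using this
  have := sub_le_mul_sub_of_deriv_le (f := fun t => -f (c s + t • N))
    (f' := fun t => -fderiv ℝ f (c s + t • N) N) (g := fun t => t) (g' := fun _ => 1) (L := 0) hρs
    (fun t ht => by
      have hd : HasDerivAt (fun t : ℝ => c s + t • N) N t := by
        simpa using ((hasDerivAt_id t).smul_const N).const_add (c s)
      exact (hasDerivAt_comp_curve (f := f) (c := fun t : ℝ => c s + t • N)
        ((hgood _ (hseg t ht)).1.contDiffAt.differentiableAt (by norm_num)) hd).neg)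
    (fun t _ => hasDerivAt_id t)
    (fun t ht => by linarith [(hgood _ (hseg t ht)).1.transversal])
  simp only [zero_smul, add_zero, zero_mul] at this
  linarith [hp0 s hs]

end Coordinates

/-- The term containing `D²ψ` is the same non-tensorial term as in `fderiv_christoffel`; the two
cancel in the Hessian. -/
theorem fderiv_fderiv_comp {X Y Z : Type*} [NormedAddCommGroup X] [NormedSpace ℝ X]
    [NormedAddCommGroup Y] [NormedSpace ℝ Y] [NormedAddCommGroup Z] [NormedSpace ℝ Z]
    {f : Y → Z} {ψ : X → Y} {e : X} (hf : ContDiffAt ℝ 2 f (ψ e)) (hψ : ContDiffAt ℝ 2 ψ e)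
    (u v : X) : fderiv ℝ (fderiv ℝ (fun x => f (ψ x))) e u v =
      fderiv ℝ (fderiv ℝ f) (ψ e) (fderiv ℝ ψ e u) (fderiv ℝ ψ e v) +
        fderiv ℝ f (ψ e) (fderiv ℝ (fderiv ℝ ψ) e u v) := by
  have hψ1 : HasFDerivAt ψ (fderiv ℝ ψ e) e := (hψ.differentiableAt (by simp)).hasFDerivAt
  have hψ2 : HasFDerivAt (fderiv ℝ ψ) (fderiv ℝ (fderiv ℝ ψ) e) e :=
    ((hψ.fderiv_right (m := 1) (by norm_num)).differentiableAt (by simp)).hasFDerivAt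
  have hf2 : HasFDerivAt (fderiv ℝ f) (fderiv ℝ (fderiv ℝ f) (ψ e)) (ψ e) :=
    ((hf.fderiv_right (m := 1) (by norm_num)).differentiableAt (by simp)).hasFDerivAt
  have h1 : fderiv ℝ (fun x => f (ψ x)) =ᶠ[𝓝 e]
      fun x => (fderiv ℝ f (ψ x)).comp (fderiv ℝ ψ x) := by
    filter_upwards [hψ.continuousAt.eventually (hf.eventually (by norm_num)),
      hψ.eventually (by norm_num)] with x hx hx'
    exact ((hx.differentiableAt (by norm_num)).hasFDerivAt.comp x
      (hx'.differentiableAt (by norm_num)).hasFDerivAt).fderiv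
  have h2 := ((hf2.comp e hψ1).clm_comp hψ2).congr_of_eventuallyEq h1
  rw [h2.fderiv]
  simp [add_comm]

/-- An injective linear map into the dual is bijective by equality of dimensions, and continuity of
the inverse is automatic. -/
theorem isInvertible_of_nondegenerate {F : Type*} [NormedAddCommGroup F]
    [NormedSpace ℝ F] [FiniteDimensional ℝ F] {B : F →L[ℝ] F →L[ℝ] ℝ}
    (h : ∀ u, (∀ v, B u v = 0) → u = 0) : B.IsInvertible := by
  have hinj : Function.Injective (B : F →ₗ[ℝ] F →L[ℝ] ℝ) := by
    rw [← LinearMap.ker_eq_bot, LinearMap.ker_eq_bot']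
    intro u hu
    exact h u fun v => by
      have : B u = 0 := hu
      rw [this]; rfl
  have hdim : Module.finrank ℝ F = Module.finrank ℝ (F →L[ℝ] ℝ) := by
    rw [← (LinearMap.toContinuousLinearMap (𝕜 := ℝ) (E := F) (F' := ℝ)).finrank_eq]
    exact (Subspace.dual_finrank_eq (K := ℝ) (V := F)).symm
  refine ⟨(LinearEquiv.ofInjectiveOfFinrankEq (B : F →ₗ[ℝ] F →L[ℝ] ℝ) hinj
    hdim).toContinuousLinearEquiv, ?_⟩
  ext u v
  rfl

/-! ### Metrics and Hessians under change of chart -/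

section Charts

variable {F : Type*} [NormedAddCommGroup F] [NormedSpace ℝ F]
  {K : Type*} [TopologicalSpace K] {I : ModelWithCorners ℝ F K}
  {M : Type*} [TopologicalSpace M] [ChartedSpace K M]

/-- A metric that is symmetric and non-degenerate, with smooth coefficients in charts. -/
structure IsSmoothMetric (g : ∀ q : M, TangentSpace I q →L[ℝ] TangentSpace I q →L[ℝ] ℝ) :
    Prop where
  contDiffOn : ∀ p, ContDiffOn ℝ ∞ (chartMetric I g p) (extChartAt I p).target
  symm : ∀ q v w, g q v w = g q w v
  nondegenerate : ∀ q v, (∀ w, g q v w = 0) → v = 0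

theorem chartMetric_apply (g : ∀ q : M, TangentSpace I q →L[ℝ] TangentSpace I q →L[ℝ] ℝ) (p : M)
    (e u v : F) : chartMetric I g p e u v = g ((extChartAt I p).symm e)
      (mfderiv 𝓘(ℝ, F) I (extChartAt I p).symm e u)
      (mfderiv 𝓘(ℝ, F) I (extChartAt I p).symm e v) := rfl

theorem IsSmoothMetric.chartMetric_symm
    {g : ∀ q : M, TangentSpace I q →L[ℝ] TangentSpace I q →L[ℝ] ℝ} (hg : IsSmoothMetric g) (p : M)
    (e u v : F) : chartMetric I g p e u v = chartMetric I g p e v u := by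
  rw [chartMetric_apply, chartMetric_apply, hg.symm]

theorem isOpen_overlap [I.Boundaryless] (p q : M) :
    IsOpen ((extChartAt I p).target ∩ (extChartAt I p).symm ⁻¹' (extChartAt I q).source) :=
  (continuousOn_extChartAt_symm p).isOpen_inter_preimage (isOpen_extChartAt_target p)
    (isOpen_extChartAt_source q)

theorem IsSmoothMetric.contDiffAt_chartMetric [I.Boundaryless]
    {g : ∀ q : M, TangentSpace I q →L[ℝ] TangentSpace I q →L[ℝ] ℝ} (hg : IsSmoothMetric g) {p : M}
    {e : F} (he : e ∈ (extChartAt I p).target) : ContDiffAt ℝ 2 (chartMetric I g p) e :=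
  ((hg.contDiffOn p).contDiffAt ((isOpen_extChartAt_target p).mem_nhds he)).of_le
    (ENat.LEInfty.out)

variable [I.Boundaryless] [IsManifold I ∞ M]

theorem mdifferentiableAt_extChartAt_symm {p : M} {e : F} (he : e ∈ (extChartAt I p).target) :
    MDifferentiableAt 𝓘(ℝ, F) I (extChartAt I p).symm e := by
  have : IsManifold I 1 M := .of_le (n := ∞) (by simp)
  have := mdifferentiableWithinAt_extChartAt_symm (I := I) he
  rwa [I.range_eq_univ, mdifferentiableWithinAt_univ] at this

theorem isInvertible_mfderiv_extChartAt_symm {p : M} {e : F} (he : e ∈ (extChartAt I p).target) :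
    (mfderiv 𝓘(ℝ, F) I (extChartAt I p).symm e).IsInvertible := by
  have : IsManifold I 1 M := .of_le (n := ∞) (by simp)
  have := isInvertible_mfderivWithin_extChartAt_symm (I := I) he
  rwa [I.range_eq_univ, mfderivWithin_univ] at this

theorem IsSmoothMetric.isInvertible_chartMetric [FiniteDimensional ℝ F]
    {g : ∀ q : M, TangentSpace I q →L[ℝ] TangentSpace I q →L[ℝ] ℝ} (hg : IsSmoothMetric g) {p : M}
    {e : F} (he : e ∈ (extChartAt I p).target) : (chartMetric I g p e).IsInvertible := by
  have hD := isInvertible_mfderiv_extChartAt_symm (I := I) he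
  refine isInvertible_of_nondegenerate fun u hu => ?_
  have : mfderiv 𝓘(ℝ, F) I (extChartAt I p).symm e u = 0 := by
    refine hg.nondegenerate _ _ fun w => ?_
    obtain ⟨v, rfl⟩ := hD.surjective w
    exact hu v
  exact hD.injective (this.trans (map_zero _).symm)

theorem contDiffAt_chart_change {p q : M} {e : F} (he : e ∈ (extChartAt I p).target)
    (heq : (extChartAt I p).symm e ∈ (extChartAt I q).source) :
    ContDiffAt ℝ ∞ (fun x => extChartAt I q ((extChartAt I p).symm x)) e :=
  (contDiffOn_ext_coord_change (I := I) (n := ∞) q p).contDiffAt (by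
    rw [PartialEquiv.trans_source]
    exact (isOpen_overlap (I := I) p q).mem_nhds ⟨he, heq⟩)

theorem mfderiv_extChartAt_symm_eq {p q : M} {e : F} (he : e ∈ (extChartAt I p).target)
    (heq : (extChartAt I p).symm e ∈ (extChartAt I q).source) (u : F) :
    mfderiv 𝓘(ℝ, F) I (extChartAt I p).symm e u =
      mfderiv 𝓘(ℝ, F) I (extChartAt I q).symm (extChartAt I q ((extChartAt I p).symm e))
        (fderiv ℝ (fun x => extChartAt I q ((extChartAt I p).symm x)) e u) := by
  have h1 : HasMFDerivAt 𝓘(ℝ, F) 𝓘(ℝ, F)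
      (fun x => extChartAt I q ((extChartAt I p).symm x)) e
      (fderiv ℝ (fun x => extChartAt I q ((extChartAt I p).symm x)) e) :=
    ((contDiffAt_chart_change he heq).differentiableAt (by simp)).hasFDerivAt.hasMFDerivAt
  have h2 := (mdifferentiableAt_extChartAt_symm
    ((extChartAt I q).map_source heq)).hasMFDerivAt
  have h3 := h2.comp e h1
  have h4 : (extChartAt I p).symm =ᶠ[𝓝 e] (extChartAt I q).symm ∘
      (fun x => extChartAt I q ((extChartAt I p).symm x)) := by
    filter_upwards [(isOpen_overlap (I := I) p q).mem_nhds ⟨he, heq⟩] with x hx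
    exact ((extChartAt I q).left_inv hx.2).symm
  have h5 := (h3.congr_of_eventuallyEq h4).mfderiv
  exact congrArg (fun L : F →L[ℝ] F => L u) h5

theorem surjective_fderiv_chart_change {p q : M} {e : F} (he : e ∈ (extChartAt I p).target)
    (heq : (extChartAt I p).symm e ∈ (extChartAt I q).source) : Function.Surjective
      (fderiv ℝ (fun x => extChartAt I q ((extChartAt I p).symm x)) e) := by
  intro w
  obtain ⟨u, hu⟩ := (isInvertible_mfderiv_extChartAt_symm he).surjective
    (mfderiv 𝓘(ℝ, F) I (extChartAt I q).symm (extChartAt I q ((extChartAt I p).symm e)) w)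
  replace hu := (mfderiv_extChartAt_symm_eq he heq u).symm.trans hu
  exact ⟨u, (isInvertible_mfderiv_extChartAt_symm ((extChartAt I q).map_source heq)).injective hu⟩

theorem chartMetric_chart_change
    (g : ∀ q : M, TangentSpace I q →L[ℝ] TangentSpace I q →L[ℝ] ℝ) {p q : M} {e : F}
    (he : e ∈ (extChartAt I p).target)
    (heq : (extChartAt I p).symm e ∈ (extChartAt I q).source) (u v : F) :
    chartMetric I g p e u v = chartMetric I g q (extChartAt I q ((extChartAt I p).symm e))
      (fderiv ℝ (fun x => extChartAt I q ((extChartAt I p).symm x)) e u)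
      (fderiv ℝ (fun x => extChartAt I q ((extChartAt I p).symm x)) e v) := by
  -- All tangent spaces are definitionally the model space, so base points are exchanged by
  -- generalizing over the equality rather than by a dependent rewrite.
  have congr : ∀ a b : M, a = b → ∀ u v : F, g a u v = g b u v := by
    rintro a _ rfl u v; rfl
  rw [chartMetric_apply, chartMetric_apply, mfderiv_extChartAt_symm_eq he heq,
    mfderiv_extChartAt_symm_eq he heq]
  exact congr _ _ ((extChartAt I q).left_inv heq).symm _ _

theorem contDiffAt_comp_extChartAt_symm {φ : M → ℝ} {p : M} {e : F}
    (he : e ∈ (extChartAt I p).target)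
    (hφ : ContMDiffAt I 𝓘(ℝ, ℝ) 2 φ ((extChartAt I p).symm e)) :
    ContDiffAt ℝ 2 (fun x => φ ((extChartAt I p).symm x)) e := by
  have h1 : ContMDiffAt 𝓘(ℝ, F) I 2 (extChartAt I p).symm e :=
    ((contMDiffOn_extChartAt_symm (I := I) (n := ∞) p).contMDiffAt
      ((isOpen_extChartAt_target p).mem_nhds he)).of_le (ENat.LEInfty.out)
  exact contMDiffAt_iff_contDiffAt.1 (hφ.comp e h1)

theorem mfderiv_mfderiv_extChartAt_symm {φ : M → ℝ} {p : M} {e : F}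
    (he : e ∈ (extChartAt I p).target)
    (hφ : MDifferentiableAt I 𝓘(ℝ, ℝ) φ ((extChartAt I p).symm e)) (u : F) :
    mfderiv I 𝓘(ℝ, ℝ) φ ((extChartAt I p).symm e)
      (mfderiv 𝓘(ℝ, F) I (extChartAt I p).symm e u) =
      fderiv ℝ (fun x => φ ((extChartAt I p).symm x)) e u := by
  have h := (hφ.hasMFDerivAt.comp e (mdifferentiableAt_extChartAt_symm he).hasMFDerivAt).mfderiv
  rw [mfderiv_eq_fderiv] at h
  exact (congrArg (fun L : F →L[ℝ] ℝ => L u) h).symm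

variable [FiniteDimensional ℝ F] {g : ∀ q : M, TangentSpace I q →L[ℝ] TangentSpace I q →L[ℝ] ℝ}

theorem IsSmoothMetric.fderiv_chart_change_christoffel (hg : IsSmoothMetric g) {p q : M} {e : F}
    (he : e ∈ (extChartAt I p).target)
    (heq : (extChartAt I p).symm e ∈ (extChartAt I q).source) (u v : F) :
    fderiv ℝ (fun x => extChartAt I q ((extChartAt I p).symm x)) e
        (christoffel (chartMetric I g p) e u v) =
      fderiv ℝ (fderiv ℝ (fun x => extChartAt I q ((extChartAt I p).symm x))) e u v +
      christoffel (chartMetric I g q) (extChartAt I q ((extChartAt I p).symm e))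
        (fderiv ℝ (fun x => extChartAt I q ((extChartAt I p).symm x)) e u)
        (fderiv ℝ (fun x => extChartAt I q ((extChartAt I p).symm x)) e v) := by
  have hq := (extChartAt I q).map_source heq
  refine fderiv_christoffel ((contDiffAt_chart_change he heq).of_le (ENat.LEInfty.out))
    ((hg.contDiffAt_chartMetric he).differentiableAt (by norm_num))
    ((hg.contDiffAt_chartMetric hq).differentiableAt (by norm_num)) ?_
    (fun u v => hg.chartMetric_symm _ _ _ _) (hg.isInvertible_chartMetric he)
    (hg.isInvertible_chartMetric hq) (surjective_fderiv_chart_change he heq) u v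
  filter_upwards [(isOpen_overlap (I := I) p q).mem_nhds ⟨he, heq⟩] with x hx u v
  exact chartMetric_chart_change g hx.1 hx.2 u v

/-- The Hessian may be computed in any chart. -/
theorem IsSmoothMetric.hessian_eq (hg : IsSmoothMetric g) {φ : M → ℝ} {p : M} {e : F}
    (he : e ∈ (extChartAt I p).target)
    (hφ : ContMDiffAt I 𝓘(ℝ, ℝ) 2 φ ((extChartAt I p).symm e)) (u : F) :
    hessian I g φ ((extChartAt I p).symm e) (mfderiv 𝓘(ℝ, F) I (extChartAt I p).symm e u) =
      fderiv ℝ (fderiv ℝ fun x => φ ((extChartAt I p).symm x)) e u u -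
        fderiv ℝ (fun x => φ ((extChartAt I p).symm x)) e
          (christoffel (chartMetric I g p) e u u) := by
  have : IsManifold I 1 M := .of_le (n := ∞) (by simp)
  set z := (extChartAt I p).symm e with hz
  have heq : (extChartAt I p).symm e ∈ (extChartAt I z).source := mem_extChartAt_source z
  set ψ : F → F := fun x => extChartAt I z ((extChartAt I p).symm x) with hψdef
  set f : F → ℝ := fun x => φ ((extChartAt I z).symm x) with hf
  have hψ : ContDiffAt ℝ 2 ψ e := (contDiffAt_chart_change he heq).of_le (ENat.LEInfty.out)
  have hzt : ψ e ∈ (extChartAt I z).target := (extChartAt I z).map_source heq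
  have hfC : ContDiffAt ℝ 2 f (ψ e) := by
    apply contDiffAt_comp_extChartAt_symm hzt
    rw [show (extChartAt I z).symm (ψ e) = z from (extChartAt I z).left_inv heq]
    exact hφ
  have hev : (fun x => φ ((extChartAt I p).symm x)) =ᶠ[𝓝 e] fun x => f (ψ x) := by
    filter_upwards [(isOpen_overlap (I := I) p z).mem_nhds ⟨he, heq⟩] with x hx
    simp only [hf, hψdef]
    rw [(extChartAt I z).left_inv hx.2]
  have hy : mfderiv I 𝓘(ℝ, F) (extChartAt I z) z
      (mfderiv 𝓘(ℝ, F) I (extChartAt I p).symm e u) = fderiv ℝ ψ e u := by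
    have h1 : MDifferentiableAt I 𝓘(ℝ, F) (extChartAt I z) z :=
      mdifferentiableAt_extChartAt (by simp)
    have h := (h1.hasMFDerivAt.comp e (mdifferentiableAt_extChartAt_symm he).hasMFDerivAt).mfderiv
    rw [mfderiv_eq_fderiv] at h
    exact (congrArg (fun L : F →L[ℝ] F => L u) h).symm
  have h1 : fderiv ℝ (fun x => f (ψ x)) e = (fderiv ℝ f (ψ e)).comp (fderiv ℝ ψ e) :=
    ((hfC.differentiableAt (by norm_num)).hasFDerivAt.comp e
      (hψ.differentiableAt (by norm_num)).hasFDerivAt).fderiv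
  -- After both chain rules the terms `df(D²ψ(u, u))` cancel, leaving the Hessian in the chart
  -- centred at `z`.
  rw [hev.fderiv.fderiv_eq, hev.fderiv_eq, fderiv_fderiv_comp hfC hψ, h1,
    ContinuousLinearMap.comp_apply, hg.fderiv_chart_change_christoffel he heq, map_add,
    ← hψdef, add_comm (fderiv ℝ (fderiv ℝ f) (ψ e) _ _), add_sub_add_left_eq_sub, ← hy]
  rfl

end Charts

/-! ### Curves, velocities and geodesics in a fixed chart -/

section Curves

variable {F : Type*} [NormedAddCommGroup F] [NormedSpace ℝ F]
  {K : Type*} [TopologicalSpace K] {I : ModelWithCorners ℝ F K}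
  {M : Type*} [TopologicalSpace M] [ChartedSpace K M]

theorem IsLocalDefiningFunction.contMDiffAt {N U : Set M} {φ : M → ℝ}
    (h : IsLocalDefiningFunction I N U φ) {z : M} (hz : z ∈ U) : ContMDiffAt I 𝓘(ℝ, ℝ) 2 φ z :=
  h.contMDiffOn.contMDiffAt (h.isOpen.mem_nhds hz)

variable [IsManifold I ∞ M]

theorem contDiffAt_extChartAt_comp {γ : ℝ → M} {s : ℝ} (hγ : ContMDiffAt 𝓘(ℝ, ℝ) I 2 γ s) {p : M}
    (hp : γ s ∈ (extChartAt I p).source) : ContDiffAt ℝ 2 (fun r => extChartAt I p (γ r)) s := by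
  have h1 : ContMDiffAt I 𝓘(ℝ, F) 2 (extChartAt I p) (γ s) :=
    (contMDiffAt_extChartAt' (I := I) (n := ∞) (by rwa [extChartAt_source] at hp)).of_le
      ENat.LEInfty.out
  exact contMDiffAt_iff_contDiffAt.1 (h1.comp s hγ)

theorem _root_.ContDiffAt.hasDerivAt_deriv_deriv {c : ℝ → F} {s : ℝ} (hc : ContDiffAt ℝ 2 c s) :
    HasDerivAt c (deriv c s) s ∧ HasDerivAt (deriv c) (deriv (deriv c) s) s := by
  refine ⟨(hc.differentiableAt (by norm_num)).hasDerivAt, ?_⟩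
  have h1 : ContDiffAt ℝ 1 (fderiv ℝ c) s := hc.fderiv_right (by norm_num)
  have h2 : DifferentiableAt ℝ (deriv c) s :=
    (h1.differentiableAt (by norm_num)).clm_apply (differentiableAt_const (1 : ℝ))
  exact h2.hasDerivAt

theorem contDiffOn_two_of_hasDerivAt {c c₁ c₂ : ℝ → F} {J : Set ℝ} (hJ : IsOpen J)
    (h₁ : ∀ s ∈ J, HasDerivAt c (c₁ s) s) (h₂ : ∀ s ∈ J, HasDerivAt c₁ (c₂ s) s)
    (hc₂ : ContinuousOn c₂ J) : ContDiffOn ℝ 2 c J := by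
  have e : (2 : WithTop ℕ∞) = 1 + 1 := by norm_num
  have e' : (1 : WithTop ℕ∞) = 0 + 1 := by norm_num
  rw [e, contDiffOn_succ_iff_deriv_of_isOpen hJ]
  refine ⟨fun s hs => (h₁ s hs).differentiableAt.differentiableWithinAt, by simp, ?_⟩
  have hc₁ : ContDiffOn ℝ 1 c₁ J := by
    rw [e', contDiffOn_succ_iff_deriv_of_isOpen hJ]
    exact ⟨fun s hs => (h₂ s hs).differentiableAt.differentiableWithinAt, by simp,
      contDiffOn_zero.2 (hc₂.congr fun s hs => (h₂ s hs).deriv)⟩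
  exact hc₁.congr fun s hs => (h₁ s hs).deriv

variable [I.Boundaryless]

/-- The geodesic equation is invariant under a change of charts. -/
theorem IsSmoothMetric.geodesic_equation_chart_change [FiniteDimensional ℝ F]
    {g : ∀ q : M, TangentSpace I q →L[ℝ] TangentSpace I q →L[ℝ] ℝ} (hg : IsSmoothMetric g)
    {γ : ℝ → M} {s : ℝ} (hγ : ContMDiffAt 𝓘(ℝ, ℝ) I 2 γ s) {p q : M}
    (hp : γ s ∈ (extChartAt I p).source) (hq : γ s ∈ (extChartAt I q).source)
    (h : deriv (deriv fun r => extChartAt I p (γ r)) s +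
      christoffel (chartMetric I g p) (extChartAt I p (γ s))
        (deriv (fun r => extChartAt I p (γ r)) s) (deriv (fun r => extChartAt I p (γ r)) s) = 0) :
    deriv (deriv fun r => extChartAt I q (γ r)) s +
      christoffel (chartMetric I g q) (extChartAt I q (γ s))
        (deriv (fun r => extChartAt I q (γ r)) s)
        (deriv (fun r => extChartAt I q (γ r)) s) = 0 := by
  set c : ℝ → F := fun r => extChartAt I p (γ r) with hc
  have hcC : ContDiffAt ℝ 2 c s := contDiffAt_extChartAt_comp hγ hp
  set ψ : F → F := fun x => extChartAt I q ((extChartAt I p).symm x) with hψ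
  have he : c s ∈ (extChartAt I p).target := (extChartAt I p).map_source hp
  have hps : (extChartAt I p).symm (c s) = γ s := (extChartAt I p).left_inv hp
  have heq : (extChartAt I p).symm (c s) ∈ (extChartAt I q).source := by rwa [hps]
  have hψC : ContDiffAt ℝ 2 ψ (c s) :=
    (contDiffAt_chart_change he heq).of_le ENat.LEInfty.out
  have hev : (fun r => extChartAt I q (γ r)) =ᶠ[𝓝 s] fun r => ψ (c r) := by
    filter_upwards [hγ.continuousAt ((isOpen_extChartAt_source p).mem_nhds hp)] with r hr
    simp only [hψ, hc]
    rw [(extChartAt I p).left_inv hr]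
  have hd1 : deriv (fun r => ψ (c r)) =ᶠ[𝓝 s] fun r => fderiv ℝ ψ (c r) (deriv c r) := by
    filter_upwards [hcC.continuousAt.eventually (hψC.eventually (by norm_num)),
      hcC.eventually (by norm_num)] with r h1 h2
    exact (hasDerivAt_comp_curve (h1.differentiableAt (by norm_num))
      h2.hasDerivAt_deriv_deriv.1).deriv
  have hd2 := hasDerivAt_fderiv_apply hψC hcC.hasDerivAt_deriv_deriv.1 hcC.hasDerivAt_deriv_deriv.2
  have key := hg.fderiv_chart_change_christoffel he heq (deriv c s) (deriv c s)
  -- The second derivative becomes `Dψ c'' + D²ψ(c', c')`; the transformation law absorbs the last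
  -- term, so the new equation is `Dψ` applied to the old one.
  rw [hev.deriv.deriv_eq, hev.deriv_eq, hd1.deriv_eq, hd2.deriv, hd1.self_of_nhds, ← hps,
    add_right_comm, ← key, ← map_add, add_comm, h, map_zero]

theorem velocity_eq {γ : ℝ → M} {s : ℝ} (hγ : ContMDiffAt 𝓘(ℝ, ℝ) I 2 γ s) {p : M}
    (hp : γ s ∈ (extChartAt I p).source) :
    (velocity I γ s : F) = mfderiv 𝓘(ℝ, F) I (extChartAt I p).symm (extChartAt I p (γ s))
      (deriv (fun r => extChartAt I p (γ r)) s) := by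
  have h1 : HasMFDerivAt 𝓘(ℝ, ℝ) 𝓘(ℝ, F) (fun r => extChartAt I p (γ r)) s _ :=
    (contDiffAt_extChartAt_comp hγ hp).hasDerivAt_deriv_deriv.1.hasFDerivAt.hasMFDerivAt
  have h2 := (mdifferentiableAt_extChartAt_symm ((extChartAt I p).map_source hp)).hasMFDerivAt
  have hev : γ =ᶠ[𝓝 s] (extChartAt I p).symm ∘ fun r => extChartAt I p (γ r) := by
    filter_upwards [hγ.continuousAt ((isOpen_extChartAt_source p).mem_nhds hp)] with r hr
    exact ((extChartAt I p).left_inv hr).symm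
  have h3 := ((h2.comp s h1).congr_of_eventuallyEq hev).mfderiv
  rw [velocity]
  refine (congrArg (fun L : ℝ →L[ℝ] F => L 1) h3).trans ?_
  refine congrArg (fun w : F => (mfderiv 𝓘(ℝ, F) I (extChartAt I p).symm
    (extChartAt I p (γ s)) : F →L[ℝ] F) w) ?_
  exact (ContinuousLinearMap.toSpanSingleton_apply ℝ
    (deriv (fun r => extChartAt I p (γ r)) s) (1 : ℝ)).trans (one_smul _ _)

theorem isLightlike_velocity_iff
    {g : ∀ q : M, TangentSpace I q →L[ℝ] TangentSpace I q →L[ℝ] ℝ} {γ : ℝ → M} {s : ℝ}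
    (hγ : ContMDiffAt 𝓘(ℝ, ℝ) I 2 γ s) {p : M} (hp : γ s ∈ (extChartAt I p).source) :
    IsLightlike I g (γ s) (velocity I γ s) ↔ deriv (fun r => extChartAt I p (γ r)) s ≠ 0 ∧
      chartMetric I g p (extChartAt I p (γ s)) (deriv (fun r => extChartAt I p (γ r)) s)
        (deriv (fun r => extChartAt I p (γ r)) s) = 0 := by
  have congr : ∀ a b : M, a = b → ∀ u : F, g a u u = g b u u := by
    rintro a _ rfl u; rfl
  have hD := isInvertible_mfderiv_extChartAt_symm ((extChartAt I p).map_source hp)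
  have hv := velocity_eq hγ hp
  rw [IsLightlike, chartMetric_apply]
  refine and_congr (not_congr ⟨fun h => ?_, fun h => ?_⟩) ?_
  · exact hD.injective ((hv.symm.trans h).trans (map_zero _).symm)
  · exact hv.trans ((congrArg (fun w : F => (mfderiv 𝓘(ℝ, F) I (extChartAt I p).symm
      (extChartAt I p (γ s)) : F →L[ℝ] F) w) h).trans (map_zero _))
  · have e1 := congr (γ s) _ ((extChartAt I p).left_inv hp).symm (velocity I γ s : F)
    have e2 := congrArg (fun w : F =>
      g ((extChartAt I p).symm (extChartAt I p (γ s))) w w) hv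
    exact iff_of_eq (congrArg (· = 0) (e1.trans e2))

theorem mfderiv_velocity {φ : M → ℝ} {γ : ℝ → M} {s : ℝ} (hγ : ContMDiffAt 𝓘(ℝ, ℝ) I 2 γ s) {p : M}
    (hp : γ s ∈ (extChartAt I p).source) (hφ : MDifferentiableAt I 𝓘(ℝ, ℝ) φ (γ s)) :
    mfderiv I 𝓘(ℝ, ℝ) φ (γ s) (velocity I γ s) =
      fderiv ℝ (fun x => φ ((extChartAt I p).symm x)) (extChartAt I p (γ s))
        (deriv (fun r => extChartAt I p (γ r)) s) := by
  have congr : ∀ a b : M, a = b → ∀ u : F, mfderiv I 𝓘(ℝ, ℝ) φ a u = mfderiv I 𝓘(ℝ, ℝ) φ b u := by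
    rintro a _ rfl u; rfl
  have hps := (extChartAt I p).left_inv hp
  rw [← mfderiv_mfderiv_extChartAt_symm ((extChartAt I p).map_source hp) (by rwa [hps])]
  refine (congr _ _ hps.symm (velocity I γ s : F)).trans ?_
  exact congrArg (fun w : F => mfderiv I 𝓘(ℝ, ℝ) φ _ w) (velocity_eq hγ hp)

end Curves

/-! ### The local condition implies the infinitesimal one -/

section LocalImpliesInfinitesimal

variable {F : Type*} [NormedAddCommGroup F] [NormedSpace ℝ F] [FiniteDimensional ℝ F]
  {K : Type*} [TopologicalSpace K] {I : ModelWithCorners ℝ F K}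
  {M : Type*} [TopologicalSpace M] [ChartedSpace K M] [I.Boundaryless] [IsManifold I ∞ M]
  {g : ∀ q : M, TangentSpace I q →L[ℝ] TangentSpace I q →L[ℝ] ℝ}

/-- Short time existence of lightlike geodesics with prescribed initial velocity, inside a given
open set. -/
theorem IsSmoothMetric.exists_lightlike_geodesic (hg : IsSmoothMetric g) {V : Set M}
    (hV : IsOpen V) {z : M} (hz : z ∈ V) {u : F} (hu : u ≠ 0)
    (huu : chartMetric I g z (extChartAt I z z) u u = 0) :
    ∃ δ > 0, ∃ c c₁ : ℝ → F, c 0 = extChartAt I z z ∧ c₁ 0 = u ∧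
      (∀ s ∈ Ioo (-δ) δ, c s ∈ (extChartAt I z).target ∧ HasDerivAt c (c₁ s) s ∧
        HasDerivAt c₁ (-christoffel (chartMetric I g z) (c s) (c₁ s) (c₁ s)) s) ∧
      IsGeodesicOn I g (fun s => (extChartAt I z).symm (c s)) (Ioo (-δ) δ) ∧
      (∀ s ∈ Ioo (-δ) δ, IsLightlike I g ((extChartAt I z).symm (c s))
        (velocity I (fun s => (extChartAt I z).symm (c s)) s)) ∧
      ∀ s ∈ Ioo (-δ) δ, (extChartAt I z).symm (c s) ∈ V := by
  have : CompleteSpace F := FiniteDimensional.complete ℝ F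
  set e := extChartAt I z z with he
  set G := chartMetric I g z with hG
  have het : e ∈ (extChartAt I z).target := mem_extChartAt_target z
  obtain ⟨c, c₁, hc0, hc₁0, ε, hε, hc⟩ :=
    exists_geodesic (hg.contDiffAt_chartMetric het) (hg.isInvertible_chartMetric het) u
  have h0 : (0 : ℝ) ∈ Ioo (-ε) ε := ⟨by linarith, hε⟩
  have hW : IsOpen ((extChartAt I z).target ∩ (extChartAt I z).symm ⁻¹' V) :=
    (continuousOn_extChartAt_symm z).isOpen_inter_preimage (isOpen_extChartAt_target z) hV
  have hcW : ∀ᶠ s in 𝓝 (0 : ℝ), c s ∈ (extChartAt I z).target ∩ (extChartAt I z).symm ⁻¹' V := by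
    apply (hc 0 h0).1.continuousAt
    rw [hc0]
    exact hW.mem_nhds ⟨het, by rwa [mem_preimage, he, extChartAt_to_inv]⟩
  have hc₁ne : ∀ᶠ s in 𝓝 (0 : ℝ), c₁ s ≠ 0 :=
    (hc 0 h0).2.continuousAt.eventually_ne (by rwa [hc₁0])
  obtain ⟨δ', hδ', hgood⟩ := Metric.eventually_nhds_iff_ball.1 (hcW.and hc₁ne)
  set δ := min ε δ' with hδ
  have hδ0 : 0 < δ := lt_min hε hδ'
  have hJε : ∀ s ∈ Ioo (-δ) δ, s ∈ Ioo (-ε) ε := fun s hs =>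
    ⟨by linarith [hs.1, min_le_left ε δ'], hs.2.trans_le (min_le_left _ _)⟩
  have hJδ : ∀ s ∈ Ioo (-δ) δ, s ∈ Metric.ball (0 : ℝ) δ' := fun s hs => by
    rw [Metric.mem_ball, Real.dist_eq, sub_zero, abs_lt]
    exact ⟨by linarith [hs.1, min_le_right ε δ'], hs.2.trans_le (min_le_right _ _)⟩
  have h0δ : (0 : ℝ) ∈ Ioo (-δ) δ := ⟨by linarith, hδ0⟩
  have hct : ∀ s ∈ Ioo (-δ) δ, c s ∈ (extChartAt I z).target := fun s hs =>
    (hgood s (hJδ s hs)).1.1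
  have hcd : ∀ s ∈ Ioo (-δ) δ, HasDerivAt c (c₁ s) s := fun s hs => (hc s (hJε s hs)).1
  have hcd₁ : ∀ s ∈ Ioo (-δ) δ, HasDerivAt c₁ (-christoffel G (c s) (c₁ s) (c₁ s)) s :=
    fun s hs => (hc s (hJε s hs)).2
  set γ : ℝ → M := fun s => (extChartAt I z).symm (c s) with hγ
  have hcC : ContDiffOn ℝ 2 c (Ioo (-δ) δ) := by
    refine contDiffOn_two_of_hasDerivAt isOpen_Ioo hcd hcd₁ fun s hs => ?_
    have h1 : ContinuousAt (fun s => christoffelBilin G (c s)) s :=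
      ContinuousAt.comp (contDiffAt_christoffelBilin (hg.contDiffAt_chartMetric (hct s hs))
        (hg.isInvertible_chartMetric (hct s hs))).continuousAt (hcd s hs).continuousAt
    have h2 := (hcd₁ s hs).continuousAt
    have h3 := ((h1.clm_apply h2).clm_apply h2).neg
    simp only [christoffelBilin_apply] at h3
    exact h3.continuousWithinAt
  have hγC : ContMDiffOn 𝓘(ℝ, ℝ) I 2 γ (Ioo (-δ) δ) :=
    ((contMDiffOn_extChartAt_symm (I := I) (n := ∞) z).of_le ENat.LEInfty.out).comp
      (contMDiffOn_iff_contDiffOn.2 hcC) hct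
  have hγCat : ∀ s ∈ Ioo (-δ) δ, ContMDiffAt 𝓘(ℝ, ℝ) I 2 γ s := fun s hs =>
    hγC.contMDiffAt (isOpen_Ioo.mem_nhds hs)
  have hγs : ∀ s ∈ Ioo (-δ) δ, γ s ∈ (extChartAt I z).source := fun s hs =>
    (extChartAt I z).map_target (hct s hs)
  have hγc : ∀ s ∈ Ioo (-δ) δ, extChartAt I z (γ s) = c s := fun s hs =>
    (extChartAt I z).right_inv (hct s hs)
  have hev : ∀ s ∈ Ioo (-δ) δ, (fun r => extChartAt I z (γ r)) =ᶠ[𝓝 s] c := fun s hs =>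
    Filter.eventuallyEq_of_mem (isOpen_Ioo.mem_nhds hs) hγc
  have hd : ∀ s ∈ Ioo (-δ) δ, deriv (fun r => extChartAt I z (γ r)) s = c₁ s := fun s hs => by
    rw [(hev s hs).deriv_eq, (hcd s hs).deriv]
  have hdd : ∀ s ∈ Ioo (-δ) δ, deriv (deriv fun r => extChartAt I z (γ r)) s =
      -christoffel G (c s) (c₁ s) (c₁ s) := fun s hs => by
    rw [(Filter.eventuallyEq_of_mem (isOpen_Ioo.mem_nhds hs) hd).deriv_eq, (hcd₁ s hs).deriv]
  -- The energy is constant on the interval and zero at `0`, so a null initial velocity keeps the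
  -- whole geodesic null.
  have henergy : ∀ s ∈ Ioo (-δ) δ, G (c s) (c₁ s) (c₁ s) = 0 := by
    intro s hs
    have hE : ∀ s ∈ Ioo (-δ) δ, HasDerivAt (fun r => G (c r) (c₁ r) (c₁ r)) 0 s := fun s hs =>
      hasDerivAt_energy ((hg.contDiffAt_chartMetric (hct s hs)).differentiableAt (by norm_num))
        (fun u v => hg.chartMetric_symm _ _ _ _) (hg.isInvertible_chartMetric (hct s hs))
        (hcd s hs) (hcd₁ s hs)
    have := isOpen_Ioo.is_const_of_deriv_eq_zero isPreconnected_Ioo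
      (fun s hs => (hE s hs).differentiableAt.differentiableWithinAt)
      (fun s hs => (hE s hs).deriv) hs h0δ
    rw [this, hc0, hc₁0, huu]
  refine ⟨δ, hδ0, c, c₁, hc0, hc₁0, fun s hs => ⟨hct s hs, hcd s hs, hcd₁ s hs⟩,
    ⟨hγC, fun s hs => ?_⟩, fun s hs => ?_, fun s hs => (hgood s (hJδ s hs)).1.2⟩
  -- `IsGeodesicOn` uses the chart centred at `γ s`, whereas the curve solves the equation in the
  -- chart at `z`.
  · refine hg.geodesic_equation_chart_change (hγCat s hs) (hγs s hs)
      (mem_extChartAt_source (γ s)) ?_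
    rw [hdd s hs, hd s hs, hγc s hs, neg_add_cancel]
  · refine (isLightlike_velocity_iff (hγCat s hs) (hγs s hs)).2 ?_
    rw [hd s hs, hγc s hs]
    exact ⟨(hgood s (hJδ s hs)).2, henergy s hs⟩

/-- By the second derivative test `x` is a local minimum with value zero; together with `f ≤ 0` this
would make `f` vanish near `x`, and so would its second derivative. -/
theorem not_forall_nonpos_of_deriv_deriv_pos {f f₁ : ℝ → ℝ} {x f₂ : ℝ}
    (hf : ∀ᶠ s in 𝓝 x, HasDerivAt f (f₁ s) s) (hf₁ : HasDerivAt f₁ f₂ x) (h0 : f x = 0)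
    (h1 : f₁ x = 0) (h2 : 0 < f₂) : ¬ ∀ᶠ s in 𝓝 x, f s ≤ 0 := by
  intro hle
  have hd : deriv f =ᶠ[𝓝 x] f₁ := hf.mono fun s hs => hs.deriv
  have hdd : deriv (deriv f) x = f₂ := by rw [hd.deriv_eq, hf₁.deriv]
  have hmin := isLocalMin_of_deriv_deriv_pos (by rwa [hdd]) (by rw [hd.self_of_nhds, h1])
    hf.self_of_nhds.continuousAt
  have hz : f =ᶠ[𝓝 x] fun _ => 0 := by
    filter_upwards [hle, hmin] with s a b
    exact le_antisymm a (h0 ▸ b)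
  have : deriv (deriv f) x = 0 := by
    rw [hz.deriv.deriv_eq]; simp
  linarith

theorem LocLightConvexFor.infLightConvexFor (hg : IsSmoothMetric g) {N U : Set M} {φ : M → ℝ}
    (hφ : IsLocalDefiningFunction I N U φ) (h : LocLightConvexFor I g N U φ) :
    InfLightConvexFor I g N U φ := by
  intro z hz v hv hvt
  obtain ⟨V, hV, hzV, hVU, H⟩ := h z hz
  set e := extChartAt I z z with he
  have het : e ∈ (extChartAt I z).target := mem_extChartAt_target z
  have hze : (extChartAt I z).symm e = z := extChartAt_to_inv z
  obtain ⟨u, hu⟩ : ∃ u : F, mfderiv 𝓘(ℝ, F) I (extChartAt I z).symm e u = v :=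
    (isInvertible_mfderiv_extChartAt_symm het).surjective (v : F)
  have transfer : ∀ a b : M, a = b → ∀ w : F, (IsLightlike I g a w ↔ IsLightlike I g b w) ∧
      mfderiv I 𝓘(ℝ, ℝ) φ a w = mfderiv I 𝓘(ℝ, ℝ) φ b w ∧
      hessian I g φ a w = hessian I g φ b w := by
    rintro a _ rfl w; exact ⟨Iff.rfl, rfl, rfl⟩
  have hφz : ContMDiffAt I 𝓘(ℝ, ℝ) 2 φ ((extChartAt I z).symm e) := by
    rw [hze]; exact hφ.contMDiffAt hz.1
  have hu0 : u ≠ 0 := by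
    rintro rfl
    exact hv.1 (hu.symm.trans (map_zero _))
  obtain ⟨t1, t2, t3⟩ := transfer _ _ hze v
  have huu : chartMetric I g z e u u = 0 := by
    rw [chartMetric_apply]
    exact (congrArg (fun w : F => g ((extChartAt I z).symm e) w w) hu).trans (t1.2 hv).2
  have hdu : fderiv ℝ (fun x => φ ((extChartAt I z).symm x)) e u = 0 := by
    rw [← mfderiv_mfderiv_extChartAt_symm het (hφz.mdifferentiableAt (by norm_num))]
    exact (congrArg (fun w : F => mfderiv I 𝓘(ℝ, ℝ) φ ((extChartAt I z).symm e) w) hu).trans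
      (t2.trans hvt)
  have hess := hg.hessian_eq het hφz u
  have hess' : hessian I g φ z v = _ :=
    (t3.symm.trans (congrArg (fun w : F => hessian I g φ ((extChartAt I z).symm e) w) hu.symm)).trans
      hess
  rw [hess']
  by_contra! hpos
  obtain ⟨δ, hδ, c, c₁, hc0, hc₁0, hc, hgeo, hlight, hcV⟩ :=
    hg.exists_lightlike_geodesic hV hzV hu0 huu
  have h0 : (0 : ℝ) ∈ Ioo (-δ) δ := ⟨by linarith, hδ⟩
  have hγ0 : (extChartAt I z).symm (c 0) = z := by rw [hc0, ← he, hze]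
  have hJ : Ioo (-δ) δ ∈ 𝓝 (0 : ℝ) := isOpen_Ioo.mem_nhds h0
  have hγC := hgeo.1.contMDiffAt hJ
  have hle := H (-δ) δ _ (by linarith) hδ hγ0 hgeo hlight (by
    have hsrc : (extChartAt I z).symm (c 0) ∈ (extChartAt I z).source := by
      rw [hγ0]; exact mem_extChartAt_source z
    have hev : (fun r => extChartAt I z ((extChartAt I z).symm (c r))) =ᶠ[𝓝 0] c :=
      Filter.eventuallyEq_of_mem hJ fun s hs => (extChartAt I z).right_inv (hc s hs).1
    refine (mfderiv_velocity (p := z) hγC hsrc ?_).trans ?_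
    · rw [hγ0]; exact (hφ.contMDiffAt hz.1).mdifferentiableAt (by norm_num)
    · rw [hev.deriv_eq, (hc 0 h0).2.1.deriv, hc₁0, hγ0]
      exact hdu) hcV
  -- Substituting the geodesic equation for `c''`, the second derivative of `φ ∘ γ` at `0` is
  -- exactly the Hessian assumed positive.
  refine not_forall_nonpos_of_deriv_deriv_pos (x := 0)
    (f := fun s => φ ((extChartAt I z).symm (c s)))
    (f₁ := fun s => fderiv ℝ (fun x => φ ((extChartAt I z).symm x)) (c s) (c₁ s)) ?_
    (hasDerivAt_fderiv_apply ?_ (hc 0 h0).2.1 (hc 0 h0).2.2) ?_ ?_ ?_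
    (Filter.eventually_of_mem hJ hle)
  · filter_upwards [hJ] with s hs
    exact hasDerivAt_comp_curve (f := fun x => φ ((extChartAt I z).symm x))
      ((contDiffAt_comp_extChartAt_symm (hc s hs).1
      (hφ.contMDiffAt (hVU (hcV s hs)))).differentiableAt (by norm_num)) (hc s hs).2.1
  · rw [hc0]; exact contDiffAt_comp_extChartAt_symm het hφz
  · rw [hγ0, hφ.eq_zero_iff z hz.1]; exact hz.2
  · rw [hc0, hc₁0]; exact hdu
  · rw [hc0, hc₁0, map_neg, ← sub_eq_add_neg]; exact hpos

end LocalImpliesInfinitesimal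

/-! ### The infinitesimal condition implies the local one -/

section InfinitesimalImpliesLocal

variable {E : Type*} [NormedAddCommGroup E] [NormedSpace ℝ E] [FiniteDimensional ℝ E]
  {K : Type*} [TopologicalSpace K] {I : ModelWithCorners ℝ (E × ℝ) K}
  {M : Type*} [TopologicalSpace M] [ChartedSpace K M] [I.Boundaryless] [IsManifold I ∞ M]
  {g : ∀ q : M, TangentSpace I q →L[ℝ] TangentSpace I q →L[ℝ] ℝ}

/-- The coordinate result is applied in the chart centred at `z`. Stationarity enters only through
`hpos`, `hneg` and `htan`: spatial slices are spacelike, the time direction is timelike, and it is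
tangent to `N`. -/
theorem InfLightConvexFor.locLightConvexFor (hg : IsSmoothMetric g)
    (hpos : ∀ p : M, ∀ e ∈ (extChartAt I p).target, ∀ y : E, y ≠ 0 →
      0 < chartMetric I g p e (y, 0) (y, 0))
    (hneg : ∀ p : M, ∀ e ∈ (extChartAt I p).target, chartMetric I g p e (0, 1) (0, 1) < 0)
    {N U : Set M} {φ : M → ℝ} (hφ : IsLocalDefiningFunction I N U φ)
    (htan : ∀ p : M, ∀ e ∈ (extChartAt I p).target, (extChartAt I p).symm e ∈ U ∩ N →
      fderiv ℝ (fun x => φ ((extChartAt I p).symm x)) e (0, 1) = 0)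
    (h : InfLightConvexFor I g N U φ) : LocLightConvexFor I g N U φ := by
  intro z hz
  set e := extChartAt I z z with he
  have het : e ∈ (extChartAt I z).target := mem_extChartAt_target z
  have hze : (extChartAt I z).symm e = z := extChartAt_to_inv z
  have hφz : ContMDiffAt I 𝓘(ℝ, ℝ) 2 φ ((extChartAt I z).symm e) := by
    rw [hze]; exact hφ.contMDiffAt hz.1
  set f : E × ℝ → ℝ := fun x => φ ((extChartAt I z).symm x) with hf
  have hW : ∀ᶠ x in 𝓝 e, x ∈ (extChartAt I z).target ∧ (extChartAt I z).symm x ∈ U :=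
    ((continuousOn_extChartAt_symm z).isOpen_inter_preimage (isOpen_extChartAt_target z)
      hφ.isOpen).mem_nhds ⟨het, by rw [mem_preimage, hze]; exact hz.1⟩
  have hdf : fderiv ℝ f e ≠ 0 := by
    intro h0
    apply hφ.mfderiv_ne_zero z hz
    ext v
    obtain ⟨u, hu⟩ := (isInvertible_mfderiv_extChartAt_symm het).surjective (v : E × ℝ)
    have congr : ∀ a b : M, a = b → ∀ w : E × ℝ,
        mfderiv I 𝓘(ℝ, ℝ) φ a w = mfderiv I 𝓘(ℝ, ℝ) φ b w := by
      rintro a _ rfl w; rfl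
    have h1 := mfderiv_mfderiv_extChartAt_symm het (hφz.mdifferentiableAt (by norm_num)) u
    rw [← hf, h0] at h1
    refine (congr _ _ hze.symm v).trans ?_
    exact (congrArg (fun w : E × ℝ => mfderiv I 𝓘(ℝ, ℝ) φ ((extChartAt I z).symm e) w)
      hu.symm).trans h1
  obtain ⟨ε, hε, H⟩ := exists_ball_lightlike_geodesic_nonpos (hg.contDiffAt_chartMetric het)
    (hg.isInvertible_chartMetric het) (.of_forall fun x u v => hg.chartMetric_symm _ _ _ _)
    (hpos z e het) (hneg z e het) (contDiffAt_comp_extChartAt_symm het hφz)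
    (by rw [hze, hφ.eq_zero_iff z hz.1]; exact hz.2) hdf
    (hW.mono fun x hx h0 => htan z x hx.1 ⟨hx.2, (hφ.eq_zero_iff _ hx.2).1 h0⟩)
    (hW.mono fun x hx h0 u hu huu hdu => by
      have hφx := hφ.contMDiffAt hx.2
      rw [← hg.hessian_eq hx.1 hφx u]
      refine h _ ⟨hx.2, (hφ.eq_zero_iff _ hx.2).1 h0⟩ _ ⟨fun h1 => hu ?_, huu⟩ ?_
      · exact (isInvertible_mfderiv_extChartAt_symm hx.1).injective (h1.trans (map_zero _).symm)
      · rw [mfderiv_mfderiv_extChartAt_symm hx.1 (hφx.mdifferentiableAt (by norm_num))]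
        exact hdu)
  refine ⟨((extChartAt I z).source ∩ extChartAt I z ⁻¹' Metric.ball e ε) ∩ U,
    ((continuousOn_extChartAt z).isOpen_inter_preimage (isOpen_extChartAt_source z)
      Metric.isOpen_ball).inter hφ.isOpen,
    ⟨⟨mem_extChartAt_source z, Metric.mem_ball_self hε⟩, hz.1⟩, inter_subset_right, ?_⟩
  intro a b γ ha hb hγ0 hgeo hlight htan0 hγV s hs
  have hγC : ∀ s ∈ Ioo a b, ContMDiffAt 𝓘(ℝ, ℝ) I 2 γ s := fun s hs =>
    hgeo.1.contMDiffAt (isOpen_Ioo.mem_nhds hs)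
  have hsrc : ∀ s ∈ Ioo a b, γ s ∈ (extChartAt I z).source := fun s hs => (hγV s hs).1.1
  have hcC : ∀ s ∈ Ioo a b, _ := fun s hs =>
    (contDiffAt_extChartAt_comp (hγC s hs) (hsrc s hs)).hasDerivAt_deriv_deriv
  have key := H a b (fun r => extChartAt I z (γ r)) (deriv fun r => extChartAt I z (γ r)) ha hb
    (by rw [hγ0]) (fun s hs => by
      have hl := (isLightlike_velocity_iff (hγC s hs) (hsrc s hs)).1 (hlight s hs)
      have hge := hg.geodesic_equation_chart_change (hγC s hs) (mem_extChartAt_source (γ s))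
        (hsrc s hs) (hgeo.2 s hs)
      refine ⟨(hcC s hs).1, ?_, (hγV s hs).1.2, hl.1, hl.2⟩
      rw [← eq_neg_of_add_eq_zero_left hge]
      exact (hcC s hs).2) (by
      have h1 := mfderiv_velocity (φ := φ) (p := z) (hγC 0 ⟨ha, hb⟩) (hsrc 0 ⟨ha, hb⟩)
        ((hφ.contMDiffAt (hγV 0 ⟨ha, hb⟩).2).mdifferentiableAt (by norm_num))
      rw [htan0, hγ0] at h1
      exact h1.symm) s hs
  rwa [(extChartAt I z).left_inv (hsrc s hs)] at key

end InfinitesimalImpliesLocal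

/-! ### The stationary metric satisfies the hypotheses -/

section Stationary

variable {E : Type*} [NormedAddCommGroup E] [NormedSpace ℝ E]
  {S : Type*} [TopologicalSpace S] [ChartedSpace E S]

/-- Charts of the product are the identity in time, so `(0, 1)` represents `∂_t` in each of them. -/
theorem extChartAt_prod_symm_apply (p : S × ℝ) (e : E × ℝ) :
    (extChartAt (𝓘(ℝ, E).prod 𝓘(ℝ, ℝ)) p).symm e = ((extChartAt 𝓘(ℝ, E) p.1).symm e.1, e.2) := by
  rw [extChartAt_prod, extChartAt_model_space_eq_id]
  simp

theorem mem_extChartAt_prod_target_iff (p : S × ℝ) (e : E × ℝ) :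
    e ∈ (extChartAt (𝓘(ℝ, E).prod 𝓘(ℝ, ℝ)) p).target ↔ e.1 ∈ (extChartAt 𝓘(ℝ, E) p.1).target := by
  rw [extChartAt_prod, extChartAt_model_space_eq_id]
  simp

variable [IsManifold 𝓘(ℝ, E) ∞ S]

/-- Coordinate vector fields are smooth sections along the inverse chart; inserting them into `g₀`
and `ω₀` yields smooth metric coefficients. -/
theorem contMDiffOn_mfderiv_extChartAt_symm_apply (x₀ : S) (y : E) :
    ContMDiffOn 𝓘(ℝ, E) (𝓘(ℝ, E).prod 𝓘(ℝ, E)) ∞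
      (fun a : E => Bundle.TotalSpace.mk' E (E := fun x : S => TangentSpace 𝓘(ℝ, E) x)
        ((extChartAt 𝓘(ℝ, E) x₀).symm a)
        (mfderiv 𝓘(ℝ, E) 𝓘(ℝ, E) (extChartAt 𝓘(ℝ, E) x₀).symm a y))
      (extChartAt 𝓘(ℝ, E) x₀).target := by
  have : IsManifold 𝓘(ℝ, E) 1 S := .of_le (n := ∞) (by simp)
  have ho : IsOpen (extChartAt 𝓘(ℝ, E) x₀).target := isOpen_extChartAt_target x₀
  have h1 := (contMDiffOn_extChartAt_symm (I := 𝓘(ℝ, E)) (n := ∞) x₀).contMDiffOn_tangentMapWithin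
    (m := ∞) (by simp) ho.uniqueMDiffOn
  have h2 : ContMDiffOn 𝓘(ℝ, E) (𝓘(ℝ, E).prod 𝓘(ℝ, E)) ∞
      (fun a : E => (⟨a, y⟩ : TangentBundle 𝓘(ℝ, E) E)) (extChartAt 𝓘(ℝ, E) x₀).target :=
    contMDiffOn_vectorSpace_iff_contDiffOn.2 contDiffOn_const
  refine (h1.comp h2 fun a ha => ha).congr fun a ha => ?_
  simp only [Function.comp_apply, tangentMapWithin]
  rw [mfderivWithin_of_mem_nhds (ho.mem_nhds ha)]

namespace StationaryData

variable (A : StationaryData E S)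

theorem contDiffOn_g₀ (x₀ : S) (y y' : E) : ContDiffOn ℝ ∞ (fun a : E =>
    A.g₀.inner ((extChartAt 𝓘(ℝ, E) x₀).symm a)
      (mfderiv 𝓘(ℝ, E) 𝓘(ℝ, E) (extChartAt 𝓘(ℝ, E) x₀).symm a y)
      (mfderiv 𝓘(ℝ, E) 𝓘(ℝ, E) (extChartAt 𝓘(ℝ, E) x₀).symm a y'))
    (extChartAt 𝓘(ℝ, E) x₀).target := by
  have h : ContMDiffOn 𝓘(ℝ, E) (𝓘(ℝ, E).prod 𝓘(ℝ, ℝ)) ∞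
      (fun a : E => Bundle.TotalSpace.mk' ℝ (E := Bundle.Trivial S ℝ)
        ((extChartAt 𝓘(ℝ, E) x₀).symm a) (A.g₀.inner ((extChartAt 𝓘(ℝ, E) x₀).symm a)
        (mfderiv 𝓘(ℝ, E) 𝓘(ℝ, E) (extChartAt 𝓘(ℝ, E) x₀).symm a y)
        (mfderiv 𝓘(ℝ, E) 𝓘(ℝ, E) (extChartAt 𝓘(ℝ, E) x₀).symm a y')))
      (extChartAt 𝓘(ℝ, E) x₀).target := by
    apply ContMDiffOn.clm_bundle_apply₂ (F₁ := E) (F₂ := E)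
    · exact A.g₀.contMDiff.comp_contMDiffOn (contMDiffOn_extChartAt_symm (n := ∞) x₀)
    · exact contMDiffOn_mfderiv_extChartAt_symm_apply x₀ y
    · exact contMDiffOn_mfderiv_extChartAt_symm_apply x₀ y'
  intro a ha
  have h2 := h a ha
  simp only [Bundle.contMDiffWithinAt_totalSpace] at h2
  exact contMDiffWithinAt_iff_contDiffWithinAt.1 h2.2

theorem contDiffOn_ω₀ (x₀ : S) (y : E) : ContDiffOn ℝ ∞ (fun a : E =>
    A.ω₀ ((extChartAt 𝓘(ℝ, E) x₀).symm a)
      (mfderiv 𝓘(ℝ, E) 𝓘(ℝ, E) (extChartAt 𝓘(ℝ, E) x₀).symm a y))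
    (extChartAt 𝓘(ℝ, E) x₀).target := by
  have h : ContMDiffOn 𝓘(ℝ, E) (𝓘(ℝ, E).prod 𝓘(ℝ, ℝ)) ∞
      (fun a : E => Bundle.TotalSpace.mk' ℝ (E := Bundle.Trivial S ℝ)
        ((extChartAt 𝓘(ℝ, E) x₀).symm a) (A.ω₀ ((extChartAt 𝓘(ℝ, E) x₀).symm a)
        (mfderiv 𝓘(ℝ, E) 𝓘(ℝ, E) (extChartAt 𝓘(ℝ, E) x₀).symm a y)))
      (extChartAt 𝓘(ℝ, E) x₀).target := by
    apply ContMDiffOn.clm_bundle_apply (F₁ := E)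
    · exact A.ω₀_smooth.comp_contMDiffOn (contMDiffOn_extChartAt_symm (n := ∞) x₀)
    · exact contMDiffOn_mfderiv_extChartAt_symm_apply x₀ y
  intro a ha
  have h2 := h a ha
  simp only [Bundle.contMDiffWithinAt_totalSpace] at h2
  exact contMDiffWithinAt_iff_contDiffWithinAt.1 h2.2

theorem contDiffOn_β (x₀ : S) : ContDiffOn ℝ ∞ (fun a : E =>
    A.β ((extChartAt 𝓘(ℝ, E) x₀).symm a)) (extChartAt 𝓘(ℝ, E) x₀).target :=
  contMDiffOn_iff_contDiffOn.1
    (A.β_smooth.comp_contMDiffOn (contMDiffOn_extChartAt_symm (n := ∞) x₀))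

theorem metric_apply (q : S × ℝ) (v w : E × ℝ) :
    A.metric q v w = A.g₀.inner q.1 v.1 w.1 + A.ω₀ q.1 v.1 * w.2 + v.2 * A.ω₀ q.1 w.1 -
      A.β q.1 * (v.2 * w.2) := by
  have h1 : mfderiv (𝓘(ℝ, E).prod 𝓘(ℝ, ℝ)) 𝓘(ℝ, E) (Prod.fst : S × ℝ → S) q
      = ContinuousLinearMap.fst ℝ E ℝ := mfderiv_fst
  have h2 : mfderiv (𝓘(ℝ, E).prod 𝓘(ℝ, ℝ)) 𝓘(ℝ, ℝ) (Prod.snd : S × ℝ → ℝ) q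
      = ContinuousLinearMap.snd ℝ E ℝ := mfderiv_snd
  simp only [StationaryData.metric]
  rw [h1, h2]
  rfl

theorem mfderiv_extChartAt_symm_prod {p : S × ℝ} {e : E × ℝ}
    (he : e.1 ∈ (extChartAt 𝓘(ℝ, E) p.1).target) (v : E × ℝ) :
    (mfderiv 𝓘(ℝ, E × ℝ) (𝓘(ℝ, E).prod 𝓘(ℝ, ℝ))
        (extChartAt (𝓘(ℝ, E).prod 𝓘(ℝ, ℝ)) p).symm e v : E × ℝ) =
      (mfderiv 𝓘(ℝ, E) 𝓘(ℝ, E) (extChartAt 𝓘(ℝ, E) p.1).symm e.1 v.1, v.2) := by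
  have h1 : HasMFDerivAt 𝓘(ℝ, E × ℝ) 𝓘(ℝ, E)
      (fun e : E × ℝ => (extChartAt 𝓘(ℝ, E) p.1).symm e.1) e _ :=
    HasMFDerivAt.comp e (mdifferentiableAt_extChartAt_symm he).hasMFDerivAt
      (ContinuousLinearMap.fst ℝ E ℝ).hasMFDerivAt
  have h2 : HasMFDerivAt 𝓘(ℝ, E × ℝ) 𝓘(ℝ, ℝ) (fun e : E × ℝ => e.2) e _ :=
    (ContinuousLinearMap.snd ℝ E ℝ).hasMFDerivAt
  have h3 := (h1.prodMk h2).mfderiv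
  have h4 : ((extChartAt (𝓘(ℝ, E).prod 𝓘(ℝ, ℝ)) p).symm : E × ℝ → S × ℝ) =
      fun e => ((extChartAt 𝓘(ℝ, E) p.1).symm e.1, e.2) := funext (extChartAt_prod_symm_apply p)
  rw [h4]
  exact congrArg (fun L : E × ℝ →L[ℝ] E × ℝ => L v) h3

theorem chartMetric_metric {p : S × ℝ} {e : E × ℝ}
    (he : e.1 ∈ (extChartAt 𝓘(ℝ, E) p.1).target) (v w : E × ℝ) :
    chartMetric (𝓘(ℝ, E).prod 𝓘(ℝ, ℝ)) A.metric p e v w =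
      A.g₀.inner ((extChartAt 𝓘(ℝ, E) p.1).symm e.1)
        (mfderiv 𝓘(ℝ, E) 𝓘(ℝ, E) (extChartAt 𝓘(ℝ, E) p.1).symm e.1 v.1)
        (mfderiv 𝓘(ℝ, E) 𝓘(ℝ, E) (extChartAt 𝓘(ℝ, E) p.1).symm e.1 w.1) +
      A.ω₀ ((extChartAt 𝓘(ℝ, E) p.1).symm e.1)
        (mfderiv 𝓘(ℝ, E) 𝓘(ℝ, E) (extChartAt 𝓘(ℝ, E) p.1).symm e.1 v.1) * w.2 +
      v.2 * A.ω₀ ((extChartAt 𝓘(ℝ, E) p.1).symm e.1)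
        (mfderiv 𝓘(ℝ, E) 𝓘(ℝ, E) (extChartAt 𝓘(ℝ, E) p.1).symm e.1 w.1) -
      A.β ((extChartAt 𝓘(ℝ, E) p.1).symm e.1) * (v.2 * w.2) := by
  have congr : ∀ a b : S × ℝ, a = b → ∀ v v' w w' : E × ℝ, v = v' → w = w' →
      A.metric a v w = A.metric b v' w' := by
    rintro a _ rfl v _ w _ rfl rfl; rfl
  rw [chartMetric_apply]
  exact (congr _ _ (extChartAt_prod_symm_apply p e) _ _ _ _ (mfderiv_extChartAt_symm_prod he v)
    (mfderiv_extChartAt_symm_prod he w)).trans (A.metric_apply _ _ _)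

theorem isSmoothMetric [FiniteDimensional ℝ E] :
    IsSmoothMetric (I := 𝓘(ℝ, E).prod 𝓘(ℝ, ℝ)) A.metric where
  contDiffOn p := by
    refine contDiffOn_clm_apply.2 fun v => contDiffOn_clm_apply.2 fun w => ?_
    have hmaps : MapsTo (Prod.fst : E × ℝ → E) (extChartAt (𝓘(ℝ, E).prod 𝓘(ℝ, ℝ)) p).target
        (extChartAt 𝓘(ℝ, E) p.1).target := fun e he => (mem_extChartAt_prod_target_iff p e).1 he
    have hfst : ContDiffOn ℝ ∞ (Prod.fst : E × ℝ → E)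
        (extChartAt (𝓘(ℝ, E).prod 𝓘(ℝ, ℝ)) p).target := contDiffOn_fst
    have h1 := (A.contDiffOn_g₀ p.1 v.1 w.1).comp hfst hmaps
    have h2 := ((A.contDiffOn_ω₀ p.1 v.1).comp hfst hmaps).mul (contDiffOn_const (c := w.2))
    have h3 := (contDiffOn_const (c := v.2)).mul ((A.contDiffOn_ω₀ p.1 w.1).comp hfst hmaps)
    have h4 := ((A.contDiffOn_β p.1).comp hfst hmaps).mul (contDiffOn_const (c := v.2 * w.2))
    exact (((h1.add h2).add h3).sub h4).congr fun e he => A.chartMetric_metric (hmaps he) v w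
  symm q v w := by
    refine (A.metric_apply q v w).trans (Eq.trans ?_ (A.metric_apply q w v).symm)
    have := A.g₀.symm q.1 (v : E × ℝ).1 (w : E × ℝ).1
    linarith
  nondegenerate q v h := by
    obtain ⟨y, τ⟩ : E × ℝ := v
    have h1 := (A.metric_apply q (y, τ) (0, 1)).symm.trans (h ((0, 1) : E × ℝ))
    have h2 := (A.metric_apply q (y, τ) (y, τ)).symm.trans (h ((y, τ) : E × ℝ))
    have e1 : A.g₀.inner q.1 y (0 : E) = 0 := map_zero (A.g₀.inner q.1 y)
    have e2 : A.ω₀ q.1 (0 : E) = 0 := map_zero (A.ω₀ q.1)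
    simp only at h1 h2
    rw [e1, e2] at h1
    have hβ := A.β_pos q.1
    -- Orthogonality to `(0, 1)` gives `ω₀ y = β τ`; inserted into `g_L(v, v) = 0` it leaves a sum
    -- of two non-negative terms.
    have h3 : A.g₀.inner q.1 y y + A.β q.1 * τ ^ 2 = 0 := by linear_combination h2 - 2 * τ * h1
    have hy : y = 0 := by
      by_contra hy
      have := A.g₀.pos q.1 y hy
      nlinarith [mul_nonneg hβ.le (sq_nonneg τ)]
    subst hy
    rw [e1, zero_add] at h3
    have hτ : τ = 0 := by
      rcases mul_eq_zero.1 h3 with h | h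
      · exact absurd h hβ.ne'
      · exact pow_eq_zero_iff (by norm_num) |>.1 h
    rw [hτ]
    rfl

theorem chartMetric_spacelike {p : S × ℝ} {e : E × ℝ}
    (he : e ∈ (extChartAt (𝓘(ℝ, E).prod 𝓘(ℝ, ℝ)) p).target) {y : E} (hy : y ≠ 0) :
    0 < chartMetric (𝓘(ℝ, E).prod 𝓘(ℝ, ℝ)) A.metric p e (y, 0) (y, 0) := by
  have he' := (mem_extChartAt_prod_target_iff p e).1 he
  rw [A.chartMetric_metric he']
  simp only [mul_zero, zero_mul, add_zero, sub_zero]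
  refine A.g₀.pos _ _ fun h => hy ?_
  exact (isInvertible_mfderiv_extChartAt_symm he').injective (h.trans (map_zero _).symm)

theorem chartMetric_timelike {p : S × ℝ} {e : E × ℝ}
    (he : e ∈ (extChartAt (𝓘(ℝ, E).prod 𝓘(ℝ, ℝ)) p).target) :
    chartMetric (𝓘(ℝ, E).prod 𝓘(ℝ, ℝ)) A.metric p e (0, 1) (0, 1) < 0 := by
  rw [A.chartMetric_metric ((mem_extChartAt_prod_target_iff p e).1 he)]
  have h0 : (mfderiv 𝓘(ℝ, E) 𝓘(ℝ, E) (extChartAt 𝓘(ℝ, E) p.1).symm e.1 (0 : E)) = 0 := map_zero _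
  simp only
  rw [h0, map_zero, map_zero]
  simpa using A.β_pos _

end StationaryData

/-- The product hypersurface contains the vertical line through each of its points, and `Φ` vanishes
along it near the point, so its time derivative is zero there. -/
theorem fderiv_time_eq_zero {HS : Set S} {U : Set (S × ℝ)} {Φ : S × ℝ → ℝ}
    (hΦ : IsLocalDefiningFunction (𝓘(ℝ, E).prod 𝓘(ℝ, ℝ)) (HS ×ˢ (univ : Set ℝ)) U Φ) {p : S × ℝ}
    {e : E × ℝ} (he : e ∈ (extChartAt (𝓘(ℝ, E).prod 𝓘(ℝ, ℝ)) p).target)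
    (heU : (extChartAt (𝓘(ℝ, E).prod 𝓘(ℝ, ℝ)) p).symm e ∈ U ∩ HS ×ˢ (univ : Set ℝ)) :
    fderiv ℝ (fun x => Φ ((extChartAt (𝓘(ℝ, E).prod 𝓘(ℝ, ℝ)) p).symm x)) e (0, 1) = 0 := by
  set f : E × ℝ → ℝ := fun x => Φ ((extChartAt (𝓘(ℝ, E).prod 𝓘(ℝ, ℝ)) p).symm x) with hf
  have hd : DifferentiableAt ℝ f e :=
    (contDiffAt_comp_extChartAt_symm he (hΦ.contMDiffAt heU.1)).differentiableAt (by norm_num)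
  have hline : HasDerivAt (fun r : ℝ => e + r • ((0, 1) : E × ℝ)) (0, 1) 0 := by
    simpa using ((hasDerivAt_id (0 : ℝ)).smul_const ((0, 1) : E × ℝ)).const_add e
  have h1 := hasDerivAt_comp_curve (f := f) (c := fun r : ℝ => e + r • ((0, 1) : E × ℝ)) (s := 0)
    (by simpa using hd) hline
  have hW : IsOpen ((extChartAt (𝓘(ℝ, E).prod 𝓘(ℝ, ℝ)) p).target ∩
      (extChartAt (𝓘(ℝ, E).prod 𝓘(ℝ, ℝ)) p).symm ⁻¹' U) :=
    (continuousOn_extChartAt_symm p).isOpen_inter_preimage (isOpen_extChartAt_target p) hΦ.isOpen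
  have h2 : (fun r : ℝ => f (e + r • ((0, 1) : E × ℝ))) =ᶠ[𝓝 0] fun _ => 0 := by
    have hev := hline.continuousAt.preimage_mem_nhds (t := _) (hW.mem_nhds (x := _) (by
      rw [zero_smul, add_zero]; exact ⟨he, heU.1⟩))
    filter_upwards [hev] with r hr
    refine (hΦ.eq_zero_iff _ hr.2).2 ?_
    have h3 := heU.2
    rw [extChartAt_prod_symm_apply] at h3 ⊢
    simpa using h3
  have h3 := h1.unique ((hasDerivAt_const (0 : ℝ) (0 : ℝ)).congr_of_eventuallyEq h2)
  simpa using h3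

end Stationary

end LightConvexity

end

open LightConvexity in
theorem corollary3p4
    {E : Type*} [NormedAddCommGroup E] [NormedSpace ℝ E] [FiniteDimensional ℝ E]
    {S : Type*} [TopologicalSpace S] [T2Space S] [SecondCountableTopology S] [ConnectedSpace S]
    [ChartedSpace E S] [IsManifold 𝓘(ℝ, E) ∞ S]
    (A : StationaryData E S) (HS : Set S) (hHS : IsC2Hypersurface 𝓘(ℝ, E) HS) :
    (InfLightConvex (𝓘(ℝ, E).prod 𝓘(ℝ, ℝ)) A.metric (HS ×ˢ (univ : Set ℝ)) ↔
      LocLightConvex (𝓘(ℝ, E).prod 𝓘(ℝ, ℝ)) A.metric (HS ×ˢ (univ : Set ℝ))) ∧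
    ∀ (U : Set (S × ℝ)) (Φ : S × ℝ → ℝ),
      IsLocalDefiningFunction (𝓘(ℝ, E).prod 𝓘(ℝ, ℝ)) (HS ×ˢ (univ : Set ℝ)) U Φ →
      (InfLightConvexFor (𝓘(ℝ, E).prod 𝓘(ℝ, ℝ)) A.metric (HS ×ˢ (univ : Set ℝ)) U Φ ↔
        LocLightConvexFor (𝓘(ℝ, E).prod 𝓘(ℝ, ℝ)) A.metric (HS ×ˢ (univ : Set ℝ)) U Φ) := by

  have key : ∀ (U : Set (S × ℝ)) (Φ : S × ℝ → ℝ),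
      IsLocalDefiningFunction (𝓘(ℝ, E).prod 𝓘(ℝ, ℝ)) (HS ×ˢ (univ : Set ℝ)) U Φ →
      (InfLightConvexFor (𝓘(ℝ, E).prod 𝓘(ℝ, ℝ)) A.metric (HS ×ˢ (univ : Set ℝ)) U Φ ↔
        LocLightConvexFor (𝓘(ℝ, E).prod 𝓘(ℝ, ℝ)) A.metric (HS ×ˢ (univ : Set ℝ)) U Φ) :=
    fun U Φ hΦ => ⟨fun h => h.locLightConvexFor A.isSmoothMetric
        (fun _ _ he _ hy => A.chartMetric_spacelike he hy) (fun _ _ he => A.chartMetric_timelike he)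
        hΦ (fun _ _ he heU => fderiv_time_eq_zero hΦ he heU),
      fun h => h.infLightConvexFor A.isSmoothMetric hΦ⟩
  -- The same pair `(U, Φ)` witnesses both notions, so the first equivalence follows from the one
  -- with fixed sides.
  refine ⟨forall₂_congr fun z _ => exists₂_congr fun U Φ => and_congr_right fun _ => ?_, key⟩
  exact and_congr_right fun hΦ => key U Φ hΦ
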